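/- **Decidability of model checking for MPL[$E$].** A *Kripke structure* $K=(S,s_0,\delta,AP,L)$ consists of a set $S$ of states, an initial state $s_0\in S$, a transition function $\delta:S\to 2^S$ with $\delta(s)\neq\emptyset$ for all $s$, a set $AP$ of atomic propositions, and a labeling $L:S^*\to 2^{AP}$. It is *finite* if $S$ and $AP$ are finite and the label of a nonempty sequence depends only on its last state ($L(\varepsilon)$ is a separate value). $\mathit{Paths}(K,s)$ is the set of infinite sequences $p_0p_1\ldots\in S^\omega$ with $p_0=s$ and $p_{i+1}\in\delta(p_i)$ for all $i$, and $\mathit{Prefixes}(p)$ is the set of finite prefixes of $p$, including the empty one $\varepsilon$. Formulas of MPL[$E$] (monadic path logic with the equal-level predicate), over first-order variables $x,y,\ldots$ and second-order variables $X,\ldots$, are generated by $$\varphi ::= P_a(x)\mid x<y\mid x=y\mid x\in X\mid E(x,y)\mid\neg\varphi\mid\varphi\vee\varphi\mid\exists x.\varphi\mid\exists X.\varphi\qquad(a\in AP).$$ For valuations $V_1$, mapping first-order variables to elements of $S^*$, and $V_2$, mapping second-order variables to subsets of $S^*$, satisfaction $K,V_1,V_2\models\varphi$ is defined as follows: - $P_a(x)$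 holds iff $a\in L(V_1(x))$; - $x<y$ holds iff $V_1(x)$ is a (not necessarily proper) prefix of $V_1(y)$; - $x=y$ holds iff $V_1(x)=V_1(y)$; - $x\in X$ holds iff $V_1(x)\in V_2(X)$; - $E(x,y)$ holds iff $|V_1(x)|=|V_1(y)|$; - $\neg$ and $\vee$ are interpreted as usual; - $\exists x.\varphi$ holds iff $K,V_1[x\mapsto w],V_2\models\varphi$ for some finite prefix $w$ of some path $p\in\mathit{Paths}(K,s_0)$; - $\exists X.\varphi$ holds iff $K,V_1,V_2[X\mapsto\mathit{Prefixes}(p)]\models\varphi$ for some $p\in\mathit{Paths}(K,s_0)$. For a closed formula $\varphi$ (no free variables of either order), satisfaction does not depend on the valuations, and we write $K\models\varphi$. A finite Kripke structure is given to an algorithm by a finite description: number its states $0,\ldots,n-1$, name its atomic propositions by distinct natural numbers, and list, for every state, its successors and its label, together with the initial state and $L(\varepsilon)$. A formula is given by its Gödel number, with the same names for the atomic propositions. **Theorem.** Every finite Kripke structure has such a description, and the model checking problem for MPL[$E$] is decidable: there is a single computable function that, given any description of any finite Kripke structure $K$ and any closed MPL[$E$] formula $\varphi$ over the atomic propositions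 of $K$, determines whether $K\models\varphi$. -/

import Mathlib

/-- Kripke structures `(S, s₀, δ, AP, L)`. The labelling is defined on all finite sequences of
states, and every state has a successor. -/
structure KripkeStructure (S AP : Type*) where
  init : S
  δ : S → Set S
  L : List S → Set AP
  δ_nonempty : ∀ s, (δ s).Nonempty

namespace KripkeStructure

variable {S AP : Type*}

/-- `Paths(K, s)`: the infinite paths of `K` that start in `s`. -/
def Paths (K : KripkeStructure S AP) (s : S) : Set (ℕ → S) :=
  {p | p 0 = s ∧ ∀ i, p (i + 1) ∈ K.δ (p i)}

/-- Finite Kripke structures: finitely many states and atomic propositions, and the label of a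
nonempty sequence of states depends only on its last state. (The label of the empty sequence is
a separate, arbitrary value.) -/
def IsFinite (K : KripkeStructure S AP) : Prop :=
  Finite S ∧ Finite AP ∧ ∀ (v w : List S) (s : S), K.L (v ++ [s]) = K.L (w ++ [s])

end KripkeStructure

/-- `Prefixes(p)`: the finite prefixes (including the empty one) of an infinite sequence. -/
def prefixes {S : Type*} (p : ℕ → S) : Set (List S) :=
  {w | ∃ n : ℕ, w = (List.range n).map p}

/-- Formulas of MPL[E] over the atomic propositions `AP`. The first-order variables and the
second-order variables are both indexed by the natural numbers. -/
inductive MPLFormula (AP : Type*) where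
  /-- `P_a(x)` -/
  | prop (a : AP) (x : ℕ) : MPLFormula AP
  /-- `x < y` -/
  | lt (x y : ℕ) : MPLFormula AP
  /-- `x = y` -/
  | eq (x y : ℕ) : MPLFormula AP
  /-- `x ∈ X` -/
  | mem (x X : ℕ) : MPLFormula AP
  /-- `E(x, y)` -/
  | eqLevel (x y : ℕ) : MPLFormula AP
  /-- `¬ φ` -/
  | neg (φ : MPLFormula AP) : MPLFormula AP
  /-- `φ ∨ ψ` -/
  | or (φ ψ : MPLFormula AP) : MPLFormula AP
  /-- `∃ x. φ`, for a first-order variable `x` -/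
  | exFO (x : ℕ) (φ : MPLFormula AP) : MPLFormula AP
  /-- `∃ X. φ`, for a second-order variable `X` -/
  | exSO (X : ℕ) (φ : MPLFormula AP) : MPLFormula AP

namespace MPLFormula

/-- The free first-order variables of a formula. -/
def freeFO {AP : Type*} : MPLFormula AP → Finset ℕ
  | prop _ x => {x}
  | lt x y => {x, y}
  | eq x y => {x, y}
  | mem x _ => {x}
  | eqLevel x y => {x, y}
  | neg φ => φ.freeFO
  | or φ ψ => φ.freeFO ∪ ψ.freeFO
  | exFO x φ => φ.freeFO.erase x
  | exSO _ φ => φ.freeFO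

/-- The free second-order variables of a formula. -/
def freeSO {AP : Type*} : MPLFormula AP → Finset ℕ
  | prop _ _ => ∅
  | lt _ _ => ∅
  | eq _ _ => ∅
  | mem _ X => {X}
  | eqLevel _ _ => ∅
  | neg φ => φ.freeSO
  | or φ ψ => φ.freeSO ∪ ψ.freeSO
  | exFO _ φ => φ.freeSO
  | exSO X φ => φ.freeSO.erase X

/-- A formula is closed if no variable, of either order, occurs free in it. -/
def IsClosed {AP : Type*} (φ : MPLFormula AP) : Prop :=
  φ.freeFO = ∅ ∧ φ.freeSO = ∅

/-- Renaming of the atomic propositions. -/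
def map {AP AP' : Type*} (f : AP → AP') : MPLFormula AP → MPLFormula AP'
  | prop a x => prop (f a) x
  | lt x y => lt x y
  | eq x y => eq x y
  | mem x X => mem x X
  | eqLevel x y => eqLevel x y
  | neg φ => neg (φ.map f)
  | or φ ψ => or (φ.map f) (ψ.map f)
  | exFO x φ => exFO x (φ.map f)
  | exSO X φ => exSO X (φ.map f)

/-- The satisfaction relation `K, V₁, V₂ ⊨ φ`. First-order variables are assigned finite sequences
of states and second-order variables are assigned sets of finite sequences of states. -/
def Sat {S AP : Type*} (K : KripkeStructure S AP) :
    (ℕ → List S) → (ℕ → Set (List S)) → MPLFormula AP → Prop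
  | V₁, _, prop a x => a ∈ K.L (V₁ x)
  | V₁, _, lt x y => V₁ x <+: V₁ y
  | V₁, _, eq x y => V₁ x = V₁ y
  | V₁, V₂, mem x X => V₁ x ∈ V₂ X
  | V₁, _, eqLevel x y => (V₁ x).length = (V₁ y).length
  | V₁, V₂, neg φ => ¬ Sat K V₁ V₂ φ
  | V₁, V₂, or φ ψ => Sat K V₁ V₂ φ ∨ Sat K V₁ V₂ ψ
  | V₁, V₂, exFO x φ => ∃ w : List S, ∃ p ∈ K.Paths K.init,
      w ∈ prefixes p ∧ Sat K (Function.update V₁ x w) V₂ φ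
  | V₁, V₂, exSO X φ => ∃ p ∈ K.Paths K.init,
      Sat K V₁ (Function.update V₂ X (prefixes p)) φ

/-- `K ⊨ φ`. It is meant for closed formulas, whose satisfaction does not depend on the two
valuations (see `sat_congr`), so that trivial valuations stand for the empty ones. -/
def Models {S AP : Type*} (K : KripkeStructure S AP) (φ : MPLFormula AP) : Prop :=
  Sat K (fun _ => []) (fun _ => ∅) φ

/-- Satisfaction depends only on the values of the free variables. -/
theorem sat_congr {S AP : Type*} (K : KripkeStructure S AP) (φ : MPLFormula AP)
    (V₁ W₁ : ℕ → List S) (V₂ W₂ : ℕ → Set (List S))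
    (h₁ : ∀ x ∈ φ.freeFO, V₁ x = W₁ x) (h₂ : ∀ X ∈ φ.freeSO, V₂ X = W₂ X) :
    Sat K V₁ V₂ φ ↔ Sat K W₁ W₂ φ := by
  induction φ generalizing V₁ W₁ V₂ W₂ with
  | prop a x => simp_all [Sat, freeFO]
  | lt x y => simp_all [Sat, freeFO]
  | eq x y => simp_all [Sat, freeFO]
  | mem x X => simp_all [Sat, freeFO, freeSO]
  | eqLevel x y => simp_all [Sat, freeFO]
  | neg φ ih => simp only [Sat, ih V₁ W₁ V₂ W₂ h₁ h₂]
  | or φ ψ ih ih' =>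
    simp only [freeFO, freeSO, Finset.mem_union] at h₁ h₂
    simp only [Sat, ih V₁ W₁ V₂ W₂ (fun x h => h₁ x (.inl h)) (fun x h => h₂ x (.inl h)),
      ih' V₁ W₁ V₂ W₂ (fun x h => h₁ x (.inr h)) (fun x h => h₂ x (.inr h))]
  | exFO x φ ih =>
    simp only [freeFO, freeSO, Finset.mem_erase] at h₁ h₂
    simp only [Sat]
    refine exists_congr fun w => exists_congr fun p => and_congr_right fun _ =>
      and_congr_right fun _ => ih _ _ _ _ (fun y hy => ?_) h₂
    by_cases h : y = x
    · subst h; simp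
    · simp [h, h₁ y ⟨h, hy⟩]
  | exSO X φ ih =>
    simp only [freeFO, freeSO, Finset.mem_erase] at h₁ h₂
    simp only [Sat]
    refine exists_congr fun p => and_congr_right fun _ => ih _ _ _ _ h₁ (fun Y hY => ?_)
    by_cases h : Y = X
    · subst h; simp
    · simp [h, h₂ Y ⟨h, hY⟩]

/-- Gödel numbering of the formulas whose atomic propositions are natural numbers. -/
def toNat : MPLFormula ℕ → ℕ
  | prop a x => 9 * Nat.pair a x
  | lt x y => 9 * Nat.pair x y + 1
  | eq x y => 9 * Nat.pair x y + 2
  | mem x X => 9 * Nat.pair x X + 3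
  | eqLevel x y => 9 * Nat.pair x y + 4
  | neg φ => 9 * φ.toNat + 5
  | or φ ψ => 9 * Nat.pair φ.toNat ψ.toNat + 6
  | exFO x φ => 9 * Nat.pair x φ.toNat + 7
  | exSO X φ => 9 * Nat.pair X φ.toNat + 8

/-- The inverse of the numbering. -/
def ofNat (n : ℕ) : MPLFormula ℕ :=
  if n % 9 = 0 then prop (n / 9).unpair.1 (n / 9).unpair.2
  else if n % 9 = 1 then lt (n / 9).unpair.1 (n / 9).unpair.2
  else if n % 9 = 2 then eq (n / 9).unpair.1 (n / 9).unpair.2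
  else if n % 9 = 3 then mem (n / 9).unpair.1 (n / 9).unpair.2
  else if n % 9 = 4 then eqLevel (n / 9).unpair.1 (n / 9).unpair.2
  else if n % 9 = 5 then neg (ofNat (n / 9))
  else if n % 9 = 6 then or (ofNat (n / 9).unpair.1) (ofNat (n / 9).unpair.2)
  else if n % 9 = 7 then exFO (n / 9).unpair.1 (ofNat (n / 9).unpair.2)
  else exSO (n / 9).unpair.1 (ofNat (n / 9).unpair.2)
termination_by n
decreasing_by
  all_goals
    have h₁ := Nat.unpair_left_le (n / 9)
    have h₂ := Nat.unpair_right_le (n / 9)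
    omega

theorem ofNat_toNat (φ : MPLFormula ℕ) : ofNat φ.toNat = φ := by
  induction φ with
  | prop a x => rw [toNat, ofNat]; simp
  | lt x y => rw [toNat, ofNat]; simp [Nat.mul_add_div]
  | eq x y => rw [toNat, ofNat]; simp [Nat.mul_add_div]
  | mem x X => rw [toNat, ofNat]; simp [Nat.mul_add_div]
  | eqLevel x y => rw [toNat, ofNat]; simp [Nat.mul_add_div]
  | neg φ ih => rw [toNat, ofNat]; simp [Nat.mul_add_div, ih]
  | or φ ψ ih ih' => rw [toNat, ofNat]; simp [Nat.mul_add_div, ih, ih']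
  | exFO x φ ih => rw [toNat, ofNat]; simp [Nat.mul_add_div, ih]
  | exSO X φ ih => rw [toNat, ofNat]; simp [Nat.mul_add_div, ih]

theorem toNat_ofNat (n : ℕ) : (ofNat n).toNat = n := by
  induction n using Nat.strong_induction_on with
  | _ n ih =>
    have h₁ := Nat.unpair_left_le (n / 9)
    have h₂ := Nat.unpair_right_le (n / 9)
    rw [ofNat]
    split_ifs
    iterate 5 (simp only [toNat, Nat.pair_unpair]; omega)
    · simp only [toNat]; rw [ih _ (by omega)]; omega
    · simp only [toNat]; rw [ih _ (by omega), ih _ (by omega), Nat.pair_unpair]; omega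
    · simp only [toNat]; rw [ih _ (by omega), Nat.pair_unpair]; omega
    · simp only [toNat]; rw [ih _ (by omega), Nat.pair_unpair]; omega

/-- The numbering makes the set of formulas a domain for computable functions. -/
instance instDenumerable : Denumerable (MPLFormula ℕ) :=
  Denumerable.mk' ⟨toNat, ofNat, ofNat_toNat, toNat_ofNat⟩

end MPLFormula

/-- Finite descriptions of finite Kripke structures with states `0, …, n - 1`, as inputs of
algorithms. In `(T, i, l)`, the table `T` lists for every state the pair consisting of the list of
its successors and the list of the (names of the) atomic propositions in its label, `i` is the
initial state, and `l` lists the label of the empty sequence. -/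
abbrev KripkeCode : Type := List (List ℕ × List ℕ) × ℕ × List ℕ

/-- The code `c` describes the Kripke structure `K`, with `e` as numbering of the states and `ν` as
naming of the atomic propositions by natural numbers. -/
structure KripkeCode.Describes {S AP : Type*} (c : KripkeCode) (K : KripkeStructure S AP)
    (e : S ≃ Fin c.1.length) (ν : AP ↪ ℕ) : Prop where
  init : (e K.init : ℕ) = c.2.1
  mem_δ : ∀ s t : S, t ∈ K.δ s ↔ (e t : ℕ) ∈ (c.1.get (e s)).1
  mem_L : ∀ (w : List S) (s : S) (a : AP), a ∈ K.L (w ++ [s]) ↔ ν a ∈ (c.1.get (e s)).2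
  mem_L_nil : ∀ a : AP, a ∈ K.L [] ↔ ν a ∈ c.2.2

-- A valuation is turned into one infinite word: every variable owns a track over `Option S`,
-- holding either a finite prefix padded by `none` or an infinite path. Equality of levels then
-- becomes a positionwise comparison of two tracks, so the predicate $E$ is no harder than the
-- prefix order, and formulas become Büchi-style conditions on infinite words.
--
-- No automaton is constructed. A language is called recognizable when a finite congruence on
-- nonempty finite words saturates it: whether an infinite concatenation belongs to the language
-- depends only on the classes of its factors. Complement keeps the congruence, intersection uses
-- the product of two, and projection passes to sets of classes, hence one exponential
-- (`Recognizable.proj`). Atomic formulas and the conditions "prefix of a path" and "path" are local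
-- conditions on consecutive letters (`recognizable_chain`). So every formula defines a recognizable
-- language, and `classBound` computes a bound on the number of classes from the number of states
-- and the Gödel number (`recognizable_wordSat`). The alphabet `ℕ → Option S` may be infinite; this
-- is harmless, as only the number of classes is bounded.
--
-- That bound is all an algorithm needs. By a Ramsey argument and pumping
-- (`Recognizable.exists_evPeriodic`), if a word in a language with at most `M` classes has a
-- projection of period `P` from `N` on, then some word in the language has the same projection,
-- with period `M! * P` from `N + M * P` on. Starting from constant tracks and going inward through
-- the quantifiers, every witness may therefore be taken ultimately periodic with known parameters,
-- so each quantifier ranges over finitely many codes (`exists_code_iff`, `codeSat_iff`). Atomic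
-- formulas on ultimately periodic tracks are checked up to the end of the first period.
--
-- The resulting evaluation is a course-of-values recursion on the Gödel number with primitive
-- recursive steps (`combine_children`, `primrecPred_holds`), so the checker is even primitive
-- recursive.

universe u

/-! ### Infinite words and finite congruences -/

namespace OmegaWord

section Basic

variable {A D : Type*}

/-- The word obtained from `α` by removing its first `n` letters. -/
def shift (n : ℕ) (α : ℕ → A) : ℕ → A := fun i => α (n + i)

/-- The first `n` letters of `α`, followed by `β`. -/
def glue (n : ℕ) (α β : ℕ → A) : ℕ → A := fun i => if i < n then α i else β (i - n)

theorem shift_shift (m n : ℕ) (α : ℕ → A) : shift m (shift n α) = shift (n + m) α := by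
  funext i; simp [shift, Nat.add_assoc]

theorem shift_glue (n : ℕ) (α β : ℕ → A) : shift n (glue n α β) = β := by
  funext i; simp [shift, glue]

theorem glue_of_lt {n i : ℕ} (h : i < n) (α β : ℕ → A) : glue n α β i = α i := by
  simp [glue, h]

theorem glue_add (n i : ℕ) (α β : ℕ → A) : glue n α β (n + i) = β i := by
  simp [glue]

/-- `α` has period `P` from position `N` on. -/
def EvPeriodic (N P : ℕ) (α : ℕ → A) : Prop := ∀ i, N ≤ i → α (i + P) = α i

theorem EvPeriodic.mul {N P : ℕ} {α : ℕ → A} (h : EvPeriodic N P α) (k : ℕ) :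
    EvPeriodic N (k * P) α := by
  induction k with
  | zero => intro i _; simp
  | succ k ih =>
    intro i hi
    rw [Nat.succ_mul, ← Nat.add_assoc, h _ (by omega), ih i hi]

theorem EvPeriodic.of_dvd {N N' P P' : ℕ} {α : ℕ → A} (h : EvPeriodic N P α) (hN : N ≤ N')
    (hP : P ∣ P') : EvPeriodic N' P' α := by
  obtain ⟨k, rfl⟩ := hP
  intro i hi
  rw [Nat.mul_comm]
  exact h.mul k i (hN.trans hi)

/-- A property of the positions that is eventually periodic holds everywhere as soon as it holds
up to the end of the first period. -/
theorem forall_iff_forall_lt {N P : ℕ} (hP : 0 < P) {Q : ℕ → Prop} (h : EvPeriodic N P Q) :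
    (∀ i, Q i) ↔ ∀ i < N + P, Q i := by
  refine ⟨fun H i _ => H i, fun H i => ?_⟩
  induction i using Nat.strong_induction_on with
  | _ i ih =>
    by_cases hi : i < N + P
    · exact H i hi
    · have := h (i - P) (by omega)
      rw [Nat.sub_add_cancel (by omega)] at this
      rw [this]
      exact ih _ (by omega)

theorem exists_iff_exists_lt {N P : ℕ} (hP : 0 < P) {Q : ℕ → Prop} (h : EvPeriodic N P Q) :
    (∃ i, Q i) ↔ ∃ i < N + P, Q i := by
  have := forall_iff_forall_lt (N := N) (Q := fun i => ¬ Q i) hP (fun i hi => by simp only [h i hi])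
  rw [← not_iff_not]
  push Not
  exact this

theorem exists_block {f : ℕ → ℕ} (hf : StrictMono f) (h0 : f 0 = 0) (n : ℕ) :
    ∃ i j, n = f i + j ∧ j < f (i + 1) - f i := by
  induction n with
  | zero =>
    have := hf Nat.zero_lt_one
    exact ⟨0, 0, by omega, by simp only [zero_add]; omega⟩
  | succ n ih =>
    obtain ⟨i, j, hn, hj⟩ := ih
    by_cases h : j + 1 < f (i + 1) - f i
    · exact ⟨i, j + 1, by omega, h⟩
    · have := hf (Nat.lt_succ_self (i + 1))
      exact ⟨i + 1, 0, by omega, by simp only [Nat.succ_eq_add_one] at this; omega⟩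

theorem block_unique {f : ℕ → ℕ} (hf : StrictMono f) {i j i' j' : ℕ}
    (hj : j < f (i + 1) - f i) (hj' : j' < f (i' + 1) - f i') (h : f i + j = f i' + j') :
    i = i' ∧ j = j' := by
  have : i = i' := by
    rcases Nat.lt_trichotomy i i' with hlt | heq | hlt
    · have := hf.monotone (Nat.succ_le_of_lt hlt)
      simp only [Nat.succ_eq_add_one] at this
      omega
    · exact heq
    · have := hf.monotone (Nat.succ_le_of_lt hlt)
      simp only [Nat.succ_eq_add_one] at this
      omega
  subst this
  exact ⟨rfl, by omega⟩

/-- The blocks between consecutive cuts tile the positions without overlap, so witnesses chosen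
separately for each block can be assembled into one infinite word. -/
theorem exists_concat {f : ℕ → ℕ} (hf : StrictMono f) (h0 : f 0 = 0) (g : ℕ → ℕ → A) :
    ∃ γ : ℕ → A, ∀ i j, j < f (i + 1) - f i → γ (f i + j) = g i j := by
  choose I J hIJ hJ using exists_block hf h0
  refine ⟨fun n => g (I n) (J n), fun i j hj => ?_⟩
  obtain ⟨h₁, h₂⟩ := block_unique hf hj (hJ (f i + j)) (hIJ (f i + j))
  simp only [← h₁, ← h₂]

end Basic

/-- A congruence on the nonempty finite words over `A`, given as a map to the set `T` of its
classes. The finite word of length `n` is represented by any infinite word that extends it. -/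
structure Congr (T A : Type*) where
  val : (ℕ → A) → ℕ → T
  ext : ∀ {α α' : ℕ → A} {n : ℕ}, 0 < n → (∀ i < n, α i = α' i) → val α n = val α' n
  append : ∀ {α α' : ℕ → A} {n n' m m' : ℕ}, 0 < n → 0 < n' → 0 < m → 0 < m' →
    val α n = val α' n' → val (shift n α) m = val (shift n' α') m' →
    val α (n + m) = val α' (n' + m')

/-- Membership in `L` of an infinite concatenation of nonempty finite words depends only on the
classes of these words. -/
def Congr.Saturates {T A : Type*} (h : Congr T A) (L : Set (ℕ → A)) : Prop :=
  ∀ (α α' : ℕ → A) (f f' : ℕ → ℕ), StrictMono f → StrictMono f' → f 0 = 0 → f' 0 = 0 →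
    (∀ i, h.val (shift (f i) α) (f (i + 1) - f i) = h.val (shift (f' i) α') (f' (i + 1) - f' i)) →
    α ∈ L → α' ∈ L

/-- `L` is saturated by a congruence with at most `N` classes. -/
def Recognizable {A : Type u} (N : ℕ) (L : Set (ℕ → A)) : Prop :=
  ∃ (T : Type u) (_ : Finite T) (h : Congr T A), Nat.card T ≤ N ∧ h.Saturates L

/-! ### Closure under Boolean operations and projection; local conditions. -/

section Closure

variable {A D : Type u} {L L' : Set (ℕ → A)} {N N' : ℕ}

theorem Recognizable.mono (h : Recognizable N L) (hN : N ≤ N') : Recognizable N' L := by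
  obtain ⟨T, hT, c, hc, hL⟩ := h
  exact ⟨T, hT, c, hc.trans hN, hL⟩

/-- Saturation treats the two words symmetrically, so the same congruence serves the complement.
Negation therefore costs no classes. -/
theorem Recognizable.compl (h : Recognizable N L) : Recognizable N Lᶜ := by
  obtain ⟨T, hT, c, hc, hL⟩ := h
  refine ⟨T, hT, c, hc, fun α α' f f' hf hf' h0 h0' heq hα hα' => hα ?_⟩
  exact hL α' α f' f hf' hf h0' h0 (fun i => (heq i).symm) hα'

theorem Recognizable.inter (h : Recognizable N L) (h' : Recognizable N' L') :
    Recognizable (N * N') (L ∩ L') := by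
  obtain ⟨T, hT, c, hc, hL⟩ := h
  obtain ⟨T', hT', c', hc', hL'⟩ := h'
  refine ⟨T × T', inferInstance, ⟨fun α n => (c.val α n, c'.val α n), ?_, ?_⟩, ?_, ?_⟩
  · intro α α' n hn h
    rw [c.ext hn h, c'.ext hn h]
  · intro α α' n n' m m' hn hn' hm hm' h₁ h₂
    simp only [Prod.mk.injEq] at h₁ h₂ ⊢
    exact ⟨c.append hn hn' hm hm' h₁.1 h₂.1, c'.append hn hn' hm hm' h₁.2 h₂.2⟩
  · rw [Nat.card_prod]
    exact Nat.mul_le_mul hc hc'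
  · intro α α' f f' hf hf' h0 h0' heq hα
    simp only [Prod.mk.injEq] at heq
    exact ⟨hL α α' f f' hf hf' h0 h0' (fun i => (heq i).1) hα.1,
      hL' α α' f f' hf hf' h0 h0' (fun i => (heq i).2) hα.2⟩

theorem Recognizable.union (h : Recognizable N L) (h' : Recognizable N' L') :
    Recognizable (N * N') (L ∪ L') := by
  have := (h.compl.inter h'.compl).compl
  rwa [Set.compl_inter, compl_compl, compl_compl] at this

/-- The words that agree with an element of `L` after the projection `r` of the letters. -/
theorem Recognizable.proj (r : A → D) (h : Recognizable N L) :
    Recognizable (2 ^ N) {α | ∃ β ∈ L, ∀ i, r (β i) = r (α i)} := by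
  obtain ⟨T, hT, c, hc, hL⟩ := h
  -- The new class of a finite word is the set of old classes of all words with the same projection.
  -- Such sets are compatible with concatenation: cut a representative at `n`, replace both pieces
  -- by representatives on the other side, and glue. One inclusion suffices by symmetry.
  have key : ∀ {α α' : ℕ → A} {n n' m m' : ℕ}, 0 < n → 0 < n' → 0 < m → 0 < m' →
      {t | ∃ β, (∀ i, r (β i) = r (α i)) ∧ c.val β n = t} =
        {t | ∃ β, (∀ i, r (β i) = r (α' i)) ∧ c.val β n' = t} →
      {t | ∃ β, (∀ i, r (β i) = r (shift n α i)) ∧ c.val β m = t} =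
        {t | ∃ β, (∀ i, r (β i) = r (shift n' α' i)) ∧ c.val β m' = t} →
      {t | ∃ β, (∀ i, r (β i) = r (α i)) ∧ c.val β (n + m) = t} ⊆
        {t | ∃ β, (∀ i, r (β i) = r (α' i)) ∧ c.val β (n' + m') = t} := by
    rintro α α' n n' m m' hn hn' hm hm' h₁ h₂ t ⟨β, hβ, rfl⟩
    obtain ⟨β₁, hβ₁, e₁⟩ := h₁.subset ⟨β, hβ, rfl⟩
    obtain ⟨β₂, hβ₂, e₂⟩ := h₂.subset ⟨shift n β, fun i => hβ (n + i), rfl⟩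
    refine ⟨glue n' β₁ β₂, fun i => ?_, ?_⟩
    · by_cases hi : i < n'
      · rw [glue_of_lt hi, hβ₁]
      · obtain ⟨j, rfl⟩ := Nat.exists_eq_add_of_le (not_lt.1 hi)
        rw [glue_add, hβ₂]; rfl
    · refine c.append hn' hn hm' hm ?_ ?_
      · rw [← e₁]
        exact c.ext hn' fun i hi => glue_of_lt hi _ _
      · rw [shift_glue, e₂]
  refine ⟨Set T, inferInstance,
    ⟨fun α n => {t | ∃ β, (∀ i, r (β i) = r (α i)) ∧ c.val β n = t}, ?_, ?_⟩, ?_, ?_⟩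
  · have : ∀ {α α' : ℕ → A} {n : ℕ}, 0 < n → (∀ i < n, α i = α' i) →
        {t | ∃ β, (∀ i, r (β i) = r (α i)) ∧ c.val β n = t} ⊆
          {t | ∃ β, (∀ i, r (β i) = r (α' i)) ∧ c.val β n = t} := by
      rintro α α' n hn h t ⟨β, hβ, rfl⟩
      refine ⟨glue n β (shift n α'), fun i => ?_, c.ext hn fun i hi => glue_of_lt hi _ _⟩
      by_cases hi : i < n
      · rw [glue_of_lt hi, hβ, h i hi]
      · obtain ⟨j, rfl⟩ := Nat.exists_eq_add_of_le (not_lt.1 hi)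
        rw [glue_add]; rfl
    intro α α' n hn h
    exact (this hn h).antisymm (this hn fun i hi => (h i hi).symm)
  · intro α α' n n' m m' hn hn' hm hm' h₁ h₂
    exact (key hn hn' hm hm' h₁ h₂).antisymm (key hn' hn hm' hm h₁.symm h₂.symm)
  · have := Fintype.ofFinite T
    rw [Nat.card_eq_fintype_card] at hc
    rw [Nat.card_eq_fintype_card, Fintype.card_set]
    exact Nat.pow_le_pow_right (by norm_num) hc
  · rintro α α' f f' hf hf' h0 h0' heq ⟨β, hβL, hβ⟩
    have : ∀ i, ∃ γ, (∀ j, r (γ j) = r (shift (f' i) α' j)) ∧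
        c.val γ (f' (i + 1) - f' i) = c.val (shift (f i) β) (f (i + 1) - f i) := fun i =>
      (heq i).subset ⟨shift (f i) β, fun j => hβ (f i + j), rfl⟩
    -- Every block of `β` can be imitated over the corresponding block of `α'`; the imitations are
    -- concatenated, and saturation carries membership over to the result.
    choose g hg hgv using this
    obtain ⟨γ, hγ⟩ := exists_concat hf' h0' g
    refine ⟨γ, hL β γ f f' hf hf' h0 h0' (fun i => ?_) hβL, fun n => ?_⟩
    · rw [← hgv i]
      refine c.ext ?_ fun j hj => (hγ i j hj).symm
      have := hf' (Nat.lt_succ_self i)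
      simp only [Nat.succ_eq_add_one] at this
      omega
    · obtain ⟨i, j, rfl, hj⟩ := exists_block hf' h0' n
      rw [hγ i j hj, hg]; rfl

/-- Conditions on the first letter and on every pair of consecutive letters. -/
theorem recognizable_chain [Finite D] (π : A → D) (I : D → Prop) (R : D → D → Prop) :
    Recognizable (Nat.card D * Nat.card D * 2)
      {α : ℕ → A | I (π (α 0)) ∧ ∀ i, R (π (α i)) (π (α (i + 1)))} := by
  -- A finite word is remembered by its first letter, its last letter, and whether all its inner
  -- steps satisfy `R`; `Prop` accounts for the factor 2.
  refine ⟨D × D × Prop, inferInstance, ⟨fun α n => (π (α 0), π (α (n - 1)),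
    ∀ i, i + 1 < n → R (π (α i)) (π (α (i + 1)))), ?_, ?_⟩, ?_, ?_⟩
  · intro α α' n hn h
    simp only [Prod.mk.injEq]
    refine ⟨by rw [h 0 hn], by rw [h (n - 1) (by omega)], propext ?_⟩
    refine forall_congr' fun i => forall_congr' fun hi => ?_
    rw [h i (by omega), h (i + 1) hi]
  · have key : ∀ {α α' : ℕ → A} {n n' m m' : ℕ}, 0 < n → 0 < n' → 0 < m → 0 < m' →
        π (α (n - 1)) = π (α' (n' - 1)) → π (α n) = π (α' n') →
        ((∀ i, i + 1 < n → R (π (α i)) (π (α (i + 1)))) →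
          ∀ i, i + 1 < n' → R (π (α' i)) (π (α' (i + 1)))) →
        ((∀ i, i + 1 < m → R (π (α (n + i))) (π (α (n + i + 1)))) →
          ∀ i, i + 1 < m' → R (π (α' (n' + i))) (π (α' (n' + i + 1)))) →
        (∀ i, i + 1 < n + m → R (π (α i)) (π (α (i + 1)))) →
          ∀ i, i + 1 < n' + m' → R (π (α' i)) (π (α' (i + 1))) := by
      intro α α' n n' m m' hn hn' hm hm' hl hf h₁ h₂ H i hi
      rcases Nat.lt_trichotomy (i + 1) n' with hlt | heq | hlt
      · exact h₁ (fun j hj => H j (by omega)) i hlt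
      · have := H (n - 1) (by omega)
        rw [Nat.sub_add_cancel hn, hl, hf] at this
        rwa [show i = n' - 1 by omega, Nat.sub_add_cancel hn']
      · obtain ⟨j, rfl⟩ := Nat.exists_eq_add_of_le (show n' ≤ i by omega)
        exact h₂ (fun j hj => H (n + j) (by omega)) j (by omega)
    intro α α' n n' m m' hn hn' hm hm' h₁ h₂
    simp only [Prod.mk.injEq, shift, Nat.add_zero] at h₁ h₂ ⊢
    refine ⟨h₁.1, ?_, propext ⟨?_, ?_⟩⟩
    · rw [Nat.add_sub_assoc hm, Nat.add_sub_assoc hm']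
      exact h₂.2.1
    · exact key hn hn' hm hm' h₁.2.1 h₂.1 (fun H => h₁.2.2.mp H) (fun H => h₂.2.2.mp H)
    · exact key hn' hn hm' hm h₁.2.1.symm h₂.1.symm (fun H => h₁.2.2.mpr H)
        (fun H => h₂.2.2.mpr H)
  · rw [Nat.card_prod, Nat.card_prod, show Nat.card Prop = 2 by simp, Nat.mul_assoc]
  · rintro α α' f f' hf hf' h0 h0' heq ⟨hI, hR⟩
    simp only [Prod.mk.injEq, shift, Nat.add_zero] at heq
    have pos : ∀ i, f i < f (i + 1) := fun i => hf (Nat.lt_succ_self i)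
    have pos' : ∀ i, f' i < f' (i + 1) := fun i => hf' (Nat.lt_succ_self i)
    refine ⟨?_, fun n => ?_⟩
    · have := (heq 0).1
      rw [h0, h0'] at this
      rwa [← this]
    · obtain ⟨i, j, rfl, hj⟩ := exists_block hf' h0' n
      by_cases hlt : j + 1 < f' (i + 1) - f' i
      · exact (heq i).2.2.mp (fun k _ => hR (f i + k)) j hlt
      -- The step crosses a cut: it is governed by the last letter of block `i` and the first letter
      -- of block `i + 1`, both of which the classes record.
      · have h₁ := (heq i).2.1
        have h₂ := (heq (i + 1)).1
        have := hR (f (i + 1) - 1)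
        have p := pos i
        have p' := pos' i
        rw [Nat.sub_add_cancel (by omega), h₂] at this
        rw [show f i + (f (i + 1) - f i - 1) = f (i + 1) - 1 by omega,
          show f' i + (f' (i + 1) - f' i - 1) = f' i + j by omega] at h₁
        rwa [h₁, show f' (i + 1) = f' i + j + 1 by omega] at this

end Closure

/-! ### Pumping -/

/-- For every colouring of the pairs of natural numbers with finitely many colours there is an
increasing sequence whose consecutive pairs all have the same colour. -/
theorem exists_strictMono_color {T : Type*} [Finite T] (c : ℕ → ℕ → T) :
    ∃ (e : T) (s : ℕ → ℕ), StrictMono s ∧ 0 < s 0 ∧ ∀ i, c (s i) (s (i + 1)) = e := by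
  -- Along a nonprincipal ultrafilter, every finite colouring of the naturals is constant on a large
  -- set. So `j` gets the colour `χ j` that it has with almost every `k`, and `e` is the value of
  -- `χ` on almost every `j`.
  have hU : ∀ g : ℕ → T, ∃ t, ∀ᶠ k in (Filter.hyperfilter ℕ : Filter ℕ), g k = t := by
    intro g
    have := (Ultrafilter.finite_biUnion_mem_iff (f := Filter.hyperfilter ℕ) (is := Set.univ)
      (s := fun t : T => {k | g k = t}) Set.finite_univ).1
      (Filter.mem_of_superset Filter.univ_mem fun k _ => by simp)
    obtain ⟨t, -, ht⟩ := this
    exact ⟨t, ht⟩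
  have hgt : ∀ n : ℕ, ∀ᶠ k in (Filter.hyperfilter ℕ : Filter ℕ), n < k := fun n =>
    Nat.hyperfilter_le_atTop (Filter.eventually_gt_atTop n)
  choose χ hχ using fun j => hU (c j)
  obtain ⟨e, he⟩ := hU χ
  -- Three large sets of `k` meet: those beyond `j`, those with `χ k = e`, and those with `c j k = χ
  -- j`. The second allows the construction to continue from `k`.
  have step : ∀ j : {j // χ j = e}, ∃ k : {j // χ j = e}, j.1 < k.1 ∧ c j.1 k.1 = e := by
    rintro ⟨j, hj⟩
    obtain ⟨k, h₁, h₂, h₃⟩ := ((hgt j).and (he.and (hχ j))).exists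
    exact ⟨⟨k, h₂⟩, h₁, h₃.trans hj⟩
  choose next hlt hc using step
  obtain ⟨j₀, h₁, h₂⟩ := ((hgt 0).and he).exists
  let s : ℕ → {j // χ j = e} := fun n => n.rec ⟨j₀, h₂⟩ fun _ j => next j
  exact ⟨e, fun n => (s n).1, strictMono_nat_of_lt_succ fun n => hlt (s n), h₁,
    fun n => hc (s n)⟩

section Pumping

variable {A D T : Type*}

theorem Congr.append_right (h : Congr T A) {α β γ : ℕ → A} {n m k : ℕ} (hn : 0 < n) (hm : 0 < m)
    (hk : 0 < k) (he : h.val α n = h.val β m) :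
    h.val (glue n α γ) (n + k) = h.val (glue m β γ) (m + k) := by
  refine h.append hn hm hk hk ?_ (by rw [shift_glue, shift_glue])
  rw [h.ext hn fun i hi => glue_of_lt hi α γ, h.ext hm fun i hi => glue_of_lt hi β γ, he]

/-- A word whose projection is periodic can be shortened, without changing its class or its
projection, until it consists of at most as many periods as there are classes. -/
theorem Congr.exists_short [Finite T] (h : Congr T A) (r : A → D) {P : ℕ} (hP : 0 < P) (α : ℕ → A)
    (hα : EvPeriodic 0 P fun i => r (α i)) (k : ℕ) (hk : 0 < k) :
    ∃ (β : ℕ → A) (l : ℕ), 0 < l ∧ l ≤ Nat.card T ∧ (∀ i, r (β i) = r (α i)) ∧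
      h.val β (l * P) = h.val α (k * P) := by
  induction k using Nat.strong_induction_on generalizing α with
  | _ k ih =>
    by_cases hle : k ≤ Nat.card T
    · exact ⟨α, k, hk, hle, fun _ => rfl, rfl⟩
    · have := Fintype.ofFinite T
      -- Pigeonhole on the prefixes that end at a multiple of `P`. The shift by one keeps them
      -- nonempty, as the congruence says nothing about the empty word.
      obtain ⟨a, b, hab, heq⟩ := Fintype.exists_ne_map_eq_of_card_lt
        (fun i : Fin k => h.val α ((i + 1) * P)) (by
          rw [← Nat.card_eq_fintype_card, Fintype.card_fin]; omega)
      wlog hlt : a < b generalizing a b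
      · exact this b a hab.symm heq.symm (lt_of_le_of_ne (not_lt.1 hlt) hab.symm)
      have hlt' : (a : ℕ) < b := hlt
      -- The segment between the two prefixes of equal class is cut out. Its length is a multiple of
      -- `P`, so the projection does not change.
      let β := glue ((a + 1) * P) α (shift ((b + 1) * P) α)
      have hβ : ∀ i, r (β i) = r (α i) := by
        intro i
        by_cases hi : i < (a + 1) * P
        · simp only [β]; rw [glue_of_lt hi]
        · obtain ⟨j, rfl⟩ := Nat.exists_eq_add_of_le (not_lt.1 hi)
          simp only [β]
          rw [glue_add]
          have h₁ := hα.mul (b + 1) j (Nat.zero_le _)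
          have h₂ := hα.mul (a + 1) j (Nat.zero_le _)
          simp only [Nat.add_comm j] at h₁ h₂
          simp only [shift]
          rw [h₁, h₂]
      have hval : h.val β ((a + 1 + (k - (b + 1))) * P) = h.val α (k * P) := by
        have ha : 0 < (a + 1 : ℕ) * P := Nat.mul_pos (Nat.succ_pos _) hP
        have hb : 0 < (b + 1 : ℕ) * P := Nat.mul_pos (Nat.succ_pos _) hP
        have hbk := b.2
        -- The longer prefix may be the entire finite word; then no nonempty suffix is left to
        -- append.
        rcases Nat.eq_zero_or_pos (k - (b + 1)) with h0 | h0
        · have : k = b + 1 := by omega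
          rw [h0, Nat.add_zero, congrArg (fun l => h.val α (l * P)) this, ← heq]
          exact h.ext ha fun i hi => glue_of_lt hi _ _
        · have hc : 0 < (k - (b + 1)) * P := Nat.mul_pos h0 hP
          have := h.append_right (γ := shift ((b + 1) * P) α) ha hb hc heq
          rw [← Nat.add_mul, ← Nat.add_mul, Nat.add_sub_cancel' (by omega)] at this
          rw [this]
          refine h.ext (by positivity) fun i _ => ?_
          by_cases hi : i < (b + 1) * P
          · rw [glue_of_lt hi]
          · obtain ⟨j, rfl⟩ := Nat.exists_eq_add_of_le (not_lt.1 hi)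
            rw [glue_add]; rfl
      obtain ⟨γ, l, hl, hlT, hγ, hv⟩ := ih (a + 1 + (k - (b + 1))) (by omega) β
        (fun i hi => by simp only [hβ]; exact hα i hi) (by omega)
      exact ⟨γ, l, hl, hlT, fun i => (hγ i).trans (hβ i), hv.trans hval⟩

end Pumping

/-- If a word in a recognizable language has an ultimately periodic projection, then the language
contains an ultimately periodic word with the same projection and with an explicitly given
prefix length and period. -/
theorem Recognizable.exists_evPeriodic {A D : Type u} {L : Set (ℕ → A)} {M : ℕ}
    (hL : Recognizable M L) (r : A → D) {N P : ℕ} (hN : 0 < N) (hP : 0 < P) {β : ℕ → A}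
    (hβ : β ∈ L) (hr : EvPeriodic N P fun i => r (β i)) :
    ∃ γ ∈ L, (∀ i, r (γ i) = r (β i)) ∧ EvPeriodic (N + M * P) (M.factorial * P) γ := by
  obtain ⟨T, hT, h, hM, hs⟩ := hL
  -- The pair `j`, `k` is coloured by the class of the factor of `β` from `N + j * P` to `N + k *
  -- P`. Beyond `s 0`, this factors `β` into blocks of a single class, each consisting of whole
  -- periods of the projection.
  obtain ⟨e, s, hsm, hs0, hse⟩ := exists_strictMono_color
    fun j k => h.val (shift (N + j * P) β) ((k - j) * P)
  have hsh : ∀ j, ∀ i, r (shift (N + j * P) β i) = r (shift N β i) := by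
    intro j i
    have := hr.mul j (N + i) (by omega)
    simp only [shift] at this ⊢
    rw [← this]
    congr 2; omega
  have hper : EvPeriodic 0 P fun i => r (shift N β i) := by
    intro i _
    have := hr (N + i) (by omega)
    simp only [shift, ← Nat.add_assoc] at this ⊢
    rw [← this]
  obtain ⟨β₁, k₁, hk₁, hk₁M, hr₁, hv₁⟩ := h.exists_short r hP (shift N β) hper (s 0) hs0
  have hs01 : s 0 < s 1 := hsm Nat.zero_lt_one
  obtain ⟨β₂, k₂, hk₂, hk₂M, hr₂, hv₂⟩ := h.exists_short r hP (shift (N + s 0 * P) β)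
    (fun i hi => by simp only [hsh]; exact hper i hi) (s 1 - s 0) (by omega)
  replace hr₂ : ∀ i, r (β₂ i) = r (shift N β i) := fun i => (hr₂ i).trans (hsh _ i)
  have hp₁ : 0 < k₁ * P := Nat.mul_pos hk₁ hP
  have hp₂ : 0 < k₂ * P := Nat.mul_pos hk₂ hP
  -- The new word keeps the first `N` letters, then has the shortened part up to `s 0`, then repeats
  -- the shortened block between `s 0` and `s 1` forever.
  let ω : ℕ → A := fun i => β₂ (i % (k₂ * P))
  let γ : ℕ → A := glue N β (glue (k₁ * P) β₁ ω)
  have hγω : ∀ i, γ (N + k₁ * P + i) = ω i := by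
    intro i
    simp only [γ]
    rw [Nat.add_assoc, glue_add, glue_add]
  have hωper : ∀ i j, ω (j * (k₂ * P) + i) = ω i := by
    intro i j
    simp only [ω, Nat.mul_add_mod_self_right]
  have hrω : ∀ i, r (ω i) = r (shift N β i) := by
    intro i
    have := hper.mul (i / (k₂ * P) * k₂) (i % (k₂ * P)) (Nat.zero_le _)
    rw [Nat.mul_assoc, Nat.mod_add_div'] at this
    beta_reduce at this
    simp only [ω]
    rw [hr₂, this]
  refine ⟨γ, ?_, fun i => ?_, ?_⟩
  · refine hs β γ (fun i => if i = 0 then 0 else N + s (i - 1) * P)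
      (fun i => if i = 0 then 0 else N + k₁ * P + (i - 1) * (k₂ * P)) ?_ ?_ rfl rfl ?_ hβ
    · refine strictMono_nat_of_lt_succ fun i => ?_
      rcases i with _ | i
      · simp only [↓reduceIte, Nat.add_sub_cancel]
        simp only [Nat.zero_add, one_ne_zero, ↓reduceIte]
        omega
      · simp only [Nat.add_eq_zero_iff, one_ne_zero, and_false, ↓reduceIte, Nat.add_sub_cancel]
        have := hsm (Nat.lt_succ_self i)
        exact Nat.add_lt_add_left (Nat.mul_lt_mul_of_pos_right this hP) N
    · refine strictMono_nat_of_lt_succ fun i => ?_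
      rcases i with _ | i
      · simp only [Nat.zero_add, one_ne_zero, ↓reduceIte]
        omega
      · simp only [Nat.add_eq_zero_iff, one_ne_zero, and_false, ↓reduceIte, Nat.add_sub_cancel]
        rw [Nat.succ_mul]; omega
    · intro i
      rcases i with _ | i
      · simp only [Nat.zero_add, one_ne_zero, ↓reduceIte, Nat.sub_zero, Nat.sub_self,
          Nat.zero_mul, Nat.add_zero]
        refine h.append hN hN (Nat.mul_pos hs0 hP) hp₁ ?_ ?_
        · refine h.ext hN fun i hi => ?_
          simp only [shift, Nat.zero_add, γ]
          rw [glue_of_lt hi]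
        · rw [shift_shift, shift_shift, Nat.zero_add, ← hv₁]
          refine h.ext hp₁ fun i hi => ?_
          simp only [shift, γ]
          rw [glue_add, glue_of_lt hi]
      · simp only [Nat.add_eq_zero_iff, one_ne_zero, and_false, ↓reduceIte, Nat.add_sub_cancel]
        have hlt := hsm (Nat.lt_succ_self i)
        simp only [Nat.succ_eq_add_one] at hlt
        rw [show N + s (i + 1) * P - (N + s i * P) = (s (i + 1) - s i) * P by
            rw [Nat.sub_mul]; omega,
          show N + k₁ * P + (i + 1) * (k₂ * P) - (N + k₁ * P + i * (k₂ * P)) = k₂ * P by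
            rw [Nat.succ_mul]; omega]
        rw [hse i, ← hse 0, ← hv₂]
        refine h.ext hp₂ fun j hj => ?_
        simp only [shift]
        rw [Nat.add_assoc, hγω, hωper]
        simp only [ω]
        rw [Nat.mod_eq_of_lt hj]
  · by_cases hi : i < N
    · simp only [γ]; rw [glue_of_lt hi]
    · obtain ⟨j, rfl⟩ := Nat.exists_eq_add_of_le (not_lt.1 hi)
      simp only [γ]
      rw [glue_add]
      by_cases hj : j < k₁ * P
      · rw [glue_of_lt hj, hr₁]; rfl
      · obtain ⟨l, rfl⟩ := Nat.exists_eq_add_of_le (not_lt.1 hj)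
        rw [glue_add, hrω]
        have := hper.mul k₁ l (Nat.zero_le _)
        beta_reduce at this
        rw [← this, Nat.add_comm l]; rfl
  · have : EvPeriodic (N + k₁ * P) (k₂ * P) γ := by
      intro i hi
      obtain ⟨j, rfl⟩ := Nat.exists_eq_add_of_le hi
      rw [Nat.add_assoc, hγω, hγω, Nat.add_comm j]
      simpa using hωper j 1
    -- Only `k₁ ≤ M` and `0 < k₂ ≤ M` are known. Enlarging the start and taking `M!`, a multiple of
    -- `k₂`, gives parameters that depend on `M`, `N` and `P` alone.
    refine this.of_dvd ?_ ?_
    · exact Nat.add_le_add_left (Nat.mul_le_mul_right P (hk₁M.trans hM)) N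
    · exact Nat.mul_dvd_mul_right (Nat.dvd_factorial hk₂ (hk₂M.trans hM)) P

end OmegaWord

open OmegaWord

/-! ### Formulas over infinite words

A valuation is turned into an infinite word whose letters assign an element of `Option S` to every
track. Track `2 * x` holds the value of the first-order variable `x`, a finite sequence padded by
`none`, and track `2 * X + 1` holds the path of which the value of the second-order variable `X` is
the set of prefixes. -/

namespace KripkeStructure

variable {S AP : Type*}

/-- A path of `K` continues with `o'` after `o`. -/
def Step (K : KripkeStructure S AP) (o o' : Option S) : Prop :=
  ∃ s t, o = some s ∧ o' = some t ∧ t ∈ K.δ s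

/-- `τ` is a finite prefix of a path, padded by `none`. -/
def IsNodeTrack (K : KripkeStructure S AP) (τ : ℕ → Option S) : Prop :=
  ((τ 0 = none ∨ τ 0 = some K.init) ∧ ∀ i, τ (i + 1) = none ∨ K.Step (τ i) (τ (i + 1))) ∧
    ∃ i, τ i = none

/-- `τ` is a path. -/
def IsPathTrack (K : KripkeStructure S AP) (τ : ℕ → Option S) : Prop :=
  τ 0 = some K.init ∧ ∀ i, K.Step (τ i) (τ (i + 1))

theorem isPathTrack_iff (K : KripkeStructure S AP) (τ : ℕ → Option S) :
    K.IsPathTrack τ ↔ ∃ p ∈ K.Paths K.init, τ = fun i => some (p i) := by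
  constructor
  · rintro ⟨h0, h⟩
    have : ∀ i, ∃ s, τ i = some s := fun i => by
      obtain ⟨s, t, hs, -, -⟩ := h i
      exact ⟨s, hs⟩
    choose p hp using this
    refine ⟨p, ⟨?_, fun i => ?_⟩, funext hp⟩
    · rwa [hp, Option.some_inj] at h0
    · obtain ⟨s, t, hs, ht, hst⟩ := h i
      rw [hp, Option.some_inj] at hs ht
      rwa [hs, ht]
  · rintro ⟨p, ⟨h0, h⟩, rfl⟩
    exact ⟨congrArg some h0, fun i => ⟨_, _, rfl, rfl, h i⟩⟩

theorem isNodeTrack_iff (K : KripkeStructure S AP) (τ : ℕ → Option S) :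
    K.IsNodeTrack τ ↔
      ∃ w : List S, (∃ p ∈ K.Paths K.init, w ∈ prefixes p) ∧ τ = fun i => w[i]? := by
  constructor
  · rintro ⟨⟨h0, h⟩, hn⟩
    choose next hnext using K.δ_nonempty
    -- The path follows the track while it carries states and continues by arbitrary successors
    -- afterwards; here it matters that every state has one.
    let p : ℕ → S := fun n => n.rec K.init fun i s => (τ (i + 1)).getD (next s)
    have hp : ∀ i s, τ i = some s → p i = s := by
      rintro (_ | i) s hs
      · rcases h0 with h0 | h0 <;> simp_all [p]
      · simp [p, hs]
    classical
    refine ⟨(List.range (Nat.find hn)).map p, ⟨p, ⟨rfl, fun i => ?_⟩, _, rfl⟩, funext fun i => ?_⟩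
    · rcases h i with h | ⟨s, t, hs, ht, hst⟩
      · simp only [p, h, Option.getD_none]
        exact hnext _
      · rwa [hp _ _ hs, hp _ _ ht]
    · by_cases hi : i < Nat.find hn
      · obtain ⟨s, hs⟩ := Option.ne_none_iff_exists'.1 (Nat.find_min hn hi)
        simp [hi, hs, hp i s hs]
      · have : ∀ j, τ (Nat.find hn + j) = none := by
          intro j
          induction j with
          | zero => exact Nat.find_spec hn
          | succ j ih =>
            rcases h (Nat.find hn + j) with h | ⟨s, t, hs, -, -⟩
            · exact h
            · rw [ih] at hs; cases hs
        obtain ⟨j, rfl⟩ := Nat.exists_eq_add_of_le (not_lt.1 hi)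
        rw [this]; simp
  · rintro ⟨w, ⟨p, ⟨h0, h⟩, n, rfl⟩, rfl⟩
    refine ⟨⟨?_, fun i => ?_⟩, n, by simp⟩
    · rcases n with _ | n
      · simp
      · right; simp [h0]
    · by_cases hi : i + 1 < n
      · right
        exact ⟨p i, p (i + 1), by simp [show i < n by omega], by simp [hi], h i⟩
      · left; simpa using hi

end KripkeStructure

namespace MPLFormula

/-- Replace track `k` of `α` by `τ`. -/
def setTrack {S : Type*} (k : ℕ) (τ : ℕ → Option S) (α : ℕ → ℕ → Option S) : ℕ → ℕ → Option S :=
  fun i => Function.update (α i) k (τ i)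

/-- Satisfaction of a formula by an infinite word. -/
def WordSat {S AP : Type*} (K : KripkeStructure S AP) :
    MPLFormula AP → (ℕ → ℕ → Option S) → Prop
  | prop a x, α => (α 0 (2 * x) = none → a ∈ K.L []) ∧
      ∀ i s, α i (2 * x) = some s → α (i + 1) (2 * x) = none → a ∈ K.L [s]
  | lt x y, α => ∀ i, α i (2 * x) = none ∨ α i (2 * x) = α i (2 * y)
  | eq x y, α => ∀ i, α i (2 * x) = α i (2 * y)
  | mem x X, α => α 0 (2 * X + 1) ≠ none ∧
      ∀ i, α i (2 * x) = none ∨ α i (2 * x) = α i (2 * X + 1)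
  | eqLevel x y, α => ∀ i, α i (2 * x) = none ↔ α i (2 * y) = none
  | neg φ, α => ¬ φ.WordSat K α
  | or φ ψ, α => φ.WordSat K α ∨ ψ.WordSat K α
  | exFO x φ, α => ∃ τ, K.IsNodeTrack τ ∧ φ.WordSat K (setTrack (2 * x) τ α)
  | exSO X φ, α => ∃ τ, K.IsPathTrack τ ∧ φ.WordSat K (setTrack (2 * X + 1) τ α)

/-- The infinite word that represents a valuation. -/
def encodeVal {S : Type*} (V : ℕ → List S) (p : ℕ → Option (ℕ → S)) : ℕ → ℕ → Option S :=
  fun i k => if k % 2 = 0 then (V (k / 2))[i]? else (p (k / 2)).map fun q => q i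

/-! ### Satisfaction by a valuation agrees with satisfaction by its word. -/

section EncodeVal

variable {S AP : Type*} (V : ℕ → List S) (p : ℕ → Option (ℕ → S))

@[simp] theorem encodeVal_even (i x : ℕ) : encodeVal V p i (2 * x) = (V x)[i]? := by
  simp [encodeVal]

@[simp] theorem encodeVal_odd (i X : ℕ) :
    encodeVal V p i (2 * X + 1) = (p X).map fun q => q i := by
  have h₁ : (2 * X + 1) % 2 = 1 := by omega
  have h₂ : (2 * X + 1) / 2 = X := by omega
  simp [encodeVal, h₁, h₂]

theorem setTrack_encodeVal_even (x : ℕ) (w : List S) :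
    setTrack (2 * x) (fun i => w[i]?) (encodeVal V p) = encodeVal (Function.update V x w) p := by
  funext i k
  rcases Nat.even_or_odd' k with ⟨y, rfl | rfl⟩
  · by_cases h : y = x
    · subst h; simp [setTrack]
    · simp [setTrack, Function.update_of_ne, h]
  · simp only [setTrack, encodeVal_odd]
    rw [Function.update_of_ne (by omega), encodeVal_odd]

theorem setTrack_encodeVal_odd (X : ℕ) (q : ℕ → S) :
    setTrack (2 * X + 1) (fun i => some (q i)) (encodeVal V p) =
      encodeVal V (Function.update p X (some q)) := by
  funext i k
  rcases Nat.even_or_odd' k with ⟨y, rfl | rfl⟩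
  · simp only [setTrack, encodeVal_even]
    rw [Function.update_of_ne (by omega), encodeVal_even]
  · by_cases h : y = X
    · subst h; simp [setTrack]
    · simp [setTrack, Function.update_of_ne, h]

theorem mem_prefixes_iff (w : List S) (q : ℕ → S) :
    w ∈ prefixes q ↔ ∀ i, w[i]? = none ∨ w[i]? = some (q i) := by
  constructor
  · rintro ⟨n, rfl⟩ i
    by_cases h : i < n <;> simp_all
  · intro h
    refine ⟨w.length, List.ext_getElem? fun i => ?_⟩
    by_cases hi : i < w.length
    · have := h i
      simp_all
    · simp [hi]

theorem prefix_iff_getElem?_eq_none_or (v w : List S) :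
    v <+: w ↔ ∀ i : ℕ, v[i]? = none ∨ v[i]? = w[i]? := by
  rw [List.prefix_iff_getElem?]
  refine forall_congr' fun i => ?_
  by_cases h : i < v.length
  · simp [h, eq_comm]
  · simp [h]

theorem length_eq_iff_getElem?_eq_none (v w : List S) :
    v.length = w.length ↔ ∀ i : ℕ, v[i]? = none ↔ w[i]? = none := by
  simp only [List.getElem?_eq_none_iff]
  exact ⟨fun h i => by rw [h], fun h => Nat.le_antisymm ((h _).2 le_rfl) ((h _).1 le_rfl)⟩

/-- In a finite Kripke structure only the last state matters, and in the padded word it sits at the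
one position that carries a state and is followed by `none`. The empty sequence is recognized at
position 0. -/
theorem mem_label_iff {K : KripkeStructure S AP}
    (hK : ∀ (v w : List S) (s : S), K.L (v ++ [s]) = K.L (w ++ [s])) (w : List S) (a : AP) :
    a ∈ K.L w ↔ (w[0]? = none → a ∈ K.L []) ∧
      ∀ (i : ℕ) (s : S), w[i]? = some s → w[i + 1]? = none → a ∈ K.L [s] := by
  rcases List.eq_nil_or_concat' w with rfl | ⟨v, s, rfl⟩
  · simp
  · rw [hK v [] s, List.nil_append]
    constructor
    · refine fun h => ⟨by simp, fun i t hi hi' => ?_⟩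
      have h₁ : i < (v ++ [s]).length := by
        by_contra hlt
        rw [List.getElem?_eq_none (not_lt.1 hlt)] at hi
        cases hi
      have h₂ := List.getElem?_eq_none_iff.1 hi'
      have : i = v.length := by simp at h₁ h₂; omega
      subst this
      simp at hi
      rwa [← hi]
    · exact fun h => h.2 v.length s (by simp) (by simp)

/-- Second-order values are tracked through the path that generates them, and an unset variable
stands for the empty set. This is why membership tests position 0 of the path track: without that
test the empty sequence would belong to the empty set. -/
theorem wordSat_encodeVal {K : KripkeStructure S AP}
    (hK : ∀ (v w : List S) (s : S), K.L (v ++ [s]) = K.L (w ++ [s])) (φ : MPLFormula AP)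
    (V : ℕ → List S) (p : ℕ → Option (ℕ → S)) :
    φ.WordSat K (encodeVal V p) ↔ Sat K V (fun X => (p X).elim ∅ prefixes) φ := by
  induction φ generalizing V p with
  | prop a x =>
    simp only [WordSat, Sat, encodeVal_even]
    exact (mem_label_iff hK _ _).symm
  | lt x y =>
    simp only [WordSat, Sat, encodeVal_even]
    exact (prefix_iff_getElem?_eq_none_or _ _).symm
  | eq x y =>
    simp only [WordSat, Sat, encodeVal_even]
    exact ⟨List.ext_getElem?, fun h i => by rw [h]⟩
  | mem x X =>
    simp only [WordSat, Sat, encodeVal_even, encodeVal_odd]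
    rcases p X with _ | q
    · simp
    · simp [mem_prefixes_iff]
  | eqLevel x y =>
    simp only [WordSat, Sat, encodeVal_even]
    exact (length_eq_iff_getElem?_eq_none _ _).symm
  | neg φ ih => simp only [WordSat, Sat, ih]
  | or φ ψ ih ih' => simp only [WordSat, Sat, ih, ih']
  | exFO x φ ih =>
    simp only [WordSat, Sat, K.isNodeTrack_iff]
    constructor
    · rintro ⟨_, ⟨w, ⟨q, hq, hw⟩, rfl⟩, h⟩
      rw [setTrack_encodeVal_even, ih] at h
      exact ⟨w, q, hq, hw, h⟩
    · rintro ⟨w, q, hq, hw, h⟩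
      refine ⟨_, ⟨w, ⟨q, hq, hw⟩, rfl⟩, ?_⟩
      rwa [setTrack_encodeVal_even, ih]
  | exSO X φ ih =>
    simp only [WordSat, Sat, K.isPathTrack_iff]
    have key : ∀ q : ℕ → S, (fun Y => (Function.update p X (some q) Y).elim ∅ prefixes) =
        Function.update (fun Y => (p Y).elim ∅ prefixes) X (prefixes q) := by
      intro q
      funext Y
      by_cases h : Y = X
      · subst h; simp
      · simp [h]
    constructor
    · rintro ⟨_, ⟨q, hq, rfl⟩, h⟩
      rw [setTrack_encodeVal_odd, ih, key] at h
      exact ⟨q, hq, h⟩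
    · rintro ⟨q, hq, h⟩
      refine ⟨_, ⟨q, hq, rfl⟩, ?_⟩
      rwa [setTrack_encodeVal_odd, ih, key]

theorem models_iff_wordSat {K : KripkeStructure S AP}
    (hK : ∀ (v w : List S) (s : S), K.L (v ++ [s]) = K.L (w ++ [s])) (φ : MPLFormula AP) :
    Models K φ ↔ φ.WordSat K fun _ _ => none := by
  have h := wordSat_encodeVal hK φ (fun _ => []) fun _ => none
  have : encodeVal (fun _ => ([] : List S)) (fun _ => none) = fun _ _ => none := by
    funext i k
    simp [encodeVal]
  rw [this] at h
  exact h.symm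

end EncodeVal

/-! ### Recognizability of the formulas -/

/-- A bound on the number of classes of the congruence of a formula with Gödel number `n`, when `B`
letters can occur on each track. -/
def classBound (B : ℕ) : ℕ → ℕ
  | 0 => B * B * (B * B) * 2
  | n + 1 => 2 ^ (B * B * (B * B) * 2 * (B * B * (B * B) * 2) *
      (classBound B n * classBound B n))

section Recognizable

variable {B : ℕ}

theorem classBound_pos (hB : 0 < B) (n : ℕ) : 0 < classBound B n := by
  cases n <;> rw [classBound] <;> positivity

/-- In the exponent of `classBound B (n + 1)`, the first factors pay for the condition that the
quantified track is a prefix or a path, one copy of `classBound B n` pays for the body, and the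
power of two for the projection. The second copy is there for disjunctions. -/
theorem quant_le_classBound_succ (n : ℕ) (hB : 0 < B) :
    2 ^ (B * B * (B * B) * 2 * (B * B * (B * B) * 2) * classBound B n) ≤ classBound B (n + 1) := by
  rw [classBound]
  exact Nat.pow_le_pow_right (by norm_num) (Nat.mul_le_mul_left _
    (Nat.le_mul_of_pos_left _ (classBound_pos hB n)))

theorem body_le_classBound_succ (n : ℕ) (hB : 0 < B) :
    B * B * (B * B) * 2 * (B * B * (B * B) * 2) * classBound B n ≤ classBound B (n + 1) :=
  Nat.lt_two_pow_self.le.trans (quant_le_classBound_succ n hB)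

theorem classBound_mono (hB : 0 < B) : Monotone (classBound B) := by
  refine monotone_nat_of_le_succ fun n => le_trans ?_ (body_le_classBound_succ n hB)
  exact Nat.le_mul_of_pos_left _ (by positivity)

theorem mul_classBound_le (n : ℕ) (hB : 0 < B) :
    classBound B n * classBound B n ≤ classBound B (n + 1) := by
  rw [classBound]
  exact le_trans (Nat.le_mul_of_pos_left _ (by positivity)) Nat.lt_two_pow_self.le

variable {S : Type u}

theorem recognizable_isNodeTrack [Finite S] {AP : Type*} (K : KripkeStructure S AP) (k : ℕ)
    (hB : B = Nat.card (Option S)) :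
    Recognizable (B * B * (B * B) * 2 * (B * B * (B * B) * 2))
      {α : ℕ → ℕ → Option S | K.IsNodeTrack fun i => α i k} := by
  have hpos : 0 < B := hB ▸ Nat.card_pos
  have hle : B * B * 2 ≤ B * B * (B * B) * 2 :=
    Nat.mul_le_mul_right 2 (Nat.le_mul_of_pos_right _ (by positivity))
  have h₁ := (recognizable_chain (fun a : ℕ → Option S => a k)
    (fun o => o = none ∨ o = some K.init) fun o o' => o' = none ∨ K.Step o o')
  -- That `none` occurs somewhere is not local, but its negation is.
  have h₂ := (recognizable_chain (fun a : ℕ → Option S => a k) (fun _ => True)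
    fun o _ => o ≠ none).compl
  rw [← hB] at h₁ h₂
  convert! (h₁.mono hle).inter (h₂.mono hle) using 1
  ext α
  simp [KripkeStructure.IsNodeTrack]

theorem recognizable_isPathTrack [Finite S] {AP : Type*} (K : KripkeStructure S AP) (k : ℕ)
    (hB : B = Nat.card (Option S)) :
    Recognizable (B * B * (B * B) * 2 * (B * B * (B * B) * 2))
      {α : ℕ → ℕ → Option S | K.IsPathTrack fun i => α i k} := by
  have hpos : 0 < B := hB ▸ Nat.card_pos
  have hle : B * B * 2 ≤ B * B * (B * B) * 2 :=
    Nat.mul_le_mul_right 2 (Nat.le_mul_of_pos_right _ (by positivity))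
  have h₁ := (recognizable_chain (fun a : ℕ → Option S => a k)
    (fun o => o = some K.init) fun o o' => K.Step o o')
  rw [← hB] at h₁
  exact h₁.mono (hle.trans (Nat.le_mul_of_pos_left _ (by positivity)))

/-- Forgetting track `k` is realized as overwriting it by `none`. Two words with the same image
differ at most on that track, which turns quantification over a track into projection. -/
theorem eq_setTrack_iff (k : ℕ) (α β : ℕ → ℕ → Option S) :
    (∀ i, Function.update (β i) k none = Function.update (α i) k none) ↔
      β = setTrack k (fun i => β i k) α := by
  constructor
  · intro h
    funext i j
    by_cases hj : j = k
    · subst hj; simp [setTrack]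
    · have := congrFun (h i) j
      simpa [setTrack, hj] using this
  · intro h i
    rw [h]
    simp [setTrack]

theorem exists_track_iff (k : ℕ) (Q : (ℕ → Option S) → Prop) (L : Set (ℕ → ℕ → Option S))
    (α : ℕ → ℕ → Option S) :
    (∃ τ, Q τ ∧ setTrack k τ α ∈ L) ↔
      ∃ β ∈ {α | Q fun i => α i k} ∩ L,
        ∀ i, Function.update (β i) k none = Function.update (α i) k none := by
  constructor
  · rintro ⟨τ, hτ, h⟩
    refine ⟨setTrack k τ α, ⟨?_, h⟩, fun i => by simp [setTrack]⟩
    simpa [setTrack] using hτ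
  · rintro ⟨β, ⟨hQ, hL⟩, h⟩
    rw [eq_setTrack_iff] at h
    exact ⟨fun i => β i k, hQ, h ▸ hL⟩

/-- Atomic formulas are local conditions on a pair of tracks, with `B * B` possible letters.
Negation is complement, disjunction is union, and a quantifier intersects with the track condition
and projects. The Gödel number serves as the rank in `classBound` because it exceeds those of all
proper subformulas. -/
theorem recognizable_wordSat [Finite S] {AP : Type*} (K : KripkeStructure S AP) (ν : AP → ℕ)
    (φ : MPLFormula AP) (hB : B = Nat.card (Option S)) :
    Recognizable (classBound B (φ.map ν).toNat) {α | φ.WordSat K α} := by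
  have hpos : 0 < B := hB ▸ Nat.card_pos
  have chain : ∀ (n x y : ℕ) (I : Option S × Option S → Prop)
      (R : Option S × Option S → Option S × Option S → Prop),
      Recognizable (classBound B n) {α : ℕ → ℕ → Option S |
        I (α 0 x, α 0 y) ∧ ∀ i, R (α i x, α i y) (α (i + 1) x, α (i + 1) y)} := by
    intro n x y I R
    have h := recognizable_chain (fun a : ℕ → Option S => (a x, a y)) I R
    rw [Nat.card_prod, ← hB] at h
    exact h.mono (classBound_mono hpos (Nat.zero_le n))
  induction φ with
  | prop a x =>
    convert! chain _ (2 * x) (2 * x) (fun o => o.1 = none → a ∈ K.L [])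
      (fun o o' => ∀ s, o.1 = some s → o'.1 = none → a ∈ K.L [s]) using 1
  | lt x y =>
    convert! chain _ (2 * x) (2 * y) (fun _ => True) (fun o _ => o.1 = none ∨ o.1 = o.2) using 1
    ext α; simp [WordSat]
  | eq x y =>
    convert! chain _ (2 * x) (2 * y) (fun _ => True) (fun o _ => o.1 = o.2) using 1
    ext α; simp [WordSat]
  | mem x X =>
    convert! chain _ (2 * x) (2 * X + 1) (fun o => o.2 ≠ none)
      (fun o _ => o.1 = none ∨ o.1 = o.2) using 1
  | eqLevel x y =>
    convert! chain _ (2 * x) (2 * y) (fun _ => True) (fun o _ => o.1 = none ↔ o.2 = none) using 1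
    ext α; simp [WordSat]
  | neg φ ih => exact ih.compl.mono (classBound_mono hpos (by simp only [map, toNat]; omega))
  | or φ ψ ih ih' =>
    have h₁ := Nat.left_le_pair (φ.map ν).toNat (ψ.map ν).toNat
    have h₂ := Nat.right_le_pair (φ.map ν).toNat (ψ.map ν).toNat
    refine ((ih.mono (classBound_mono hpos h₁)).union (ih'.mono (classBound_mono hpos h₂))).mono ?_
    exact (mul_classBound_le _ hpos).trans
      (classBound_mono hpos (by simp only [map, toNat]; omega))
  | exFO x φ ih =>
    have h₂ := Nat.right_le_pair x (φ.map ν).toNat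
    have := ((recognizable_isNodeTrack K (2 * x) hB).inter ih).proj
      fun a => Function.update a (2 * x) none
    convert! this.mono ((quant_le_classBound_succ _ hpos).trans
      (classBound_mono hpos (b := ((exFO x φ).map ν).toNat) (by simp only [map, toNat]; omega)))
      using 1
    ext α
    exact exists_track_iff (2 * x) K.IsNodeTrack {α | φ.WordSat K α} α
  | exSO X φ ih =>
    have h₂ := Nat.right_le_pair X (φ.map ν).toNat
    have := ((recognizable_isPathTrack K (2 * X + 1) hB).inter ih).proj
      fun a => Function.update a (2 * X + 1) none
    convert! this.mono ((quant_le_classBound_succ _ hpos).trans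
      (classBound_mono hpos (b := ((exSO X φ).map ν).toNat) (by simp only [map, toNat]; omega)))
      using 1
    ext α
    exact exists_track_iff (2 * X + 1) K.IsPathTrack {α | φ.WordSat K α} α

/-- A track that is required to exist can be chosen ultimately periodic. -/
theorem exists_evPeriodic_track {k M N P : ℕ} {Q : (ℕ → Option S) → Prop}
    {L : Set (ℕ → ℕ → Option S)}
    (hL : Recognizable M ({α : ℕ → ℕ → Option S | Q fun i => α i k} ∩ L)) (hN : 0 < N)
    (hP : 0 < P) {α : ℕ → ℕ → Option S} (hα : EvPeriodic N P α)
    (h : ∃ τ, Q τ ∧ setTrack k τ α ∈ L) :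
    ∃ τ, Q τ ∧ setTrack k τ α ∈ L ∧ EvPeriodic (N + M * P) (M.factorial * P) τ := by
  obtain ⟨β, hβ, hr⟩ := (exists_track_iff k Q L α).1 h
  obtain ⟨γ, ⟨hQ, hγ⟩, hrγ, hper⟩ := hL.exists_evPeriodic
    (fun a => Function.update a k none) hN hP hβ (N := N) (P := P)
    (fun i hi => by simp only [hr, hα i hi])
  refine ⟨fun i => γ i k, hQ, ?_, fun i hi => by simp only [hper i hi]⟩
  rwa [← (eq_setTrack_iff k α γ).1 fun i => (hrγ i).trans (hr i)]

end Recognizable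

end MPLFormula

/-! ### Evaluation of formulas on codes

The letter `0` stands for `none` and the letter `s + 1` for the state with number `s`. An ultimately
periodic track is coded by `(m, N, P)`, where the digits of `m` are the first `N + P` letters and
`P` is a period from position `N` on. A valuation is coded by the list of the tracks that have been
set, each with its number, the most recent ones first. -/

namespace KripkeCode

/-- The number of letters of a track. -/
def numLetters (c : KripkeCode) : ℕ := c.1.length + 1

/-- The position before `N + P` that is equivalent to `i`. -/
def reducePos (N P i : ℕ) : ℕ := if i < N then i else N + (i - N) % P

/-- The letter of a coded track at a position. -/
def trackLetter (c : KripkeCode) (τ : ℕ × ℕ × ℕ) (i : ℕ) : ℕ :=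
  τ.1 / c.numLetters ^ reducePos τ.2.1 τ.2.2 i % c.numLetters

/-- The letter of track `k` of a coded valuation at a position. -/
def letter (c : KripkeCode) (ρ : List (ℕ × ℕ × ℕ × ℕ)) (k i : ℕ) : ℕ :=
  ρ.foldr (fun e d => if e.1 = k then c.trackLetter e.2 i else d) 0

/-- A path continues with the letter `d'` after the letter `d`. -/
def LetterStep (c : KripkeCode) (d d' : ℕ) : Prop :=
  0 < d ∧ 0 < d' ∧ d' - 1 ∈ (c.1.getD (d - 1) default).1

/-- The coded track is a finite prefix of a path. -/
def IsNodeCode (c : KripkeCode) (τ : ℕ × ℕ × ℕ) : Prop :=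
  ((c.trackLetter τ 0 = 0 ∨ c.trackLetter τ 0 = c.2.1 + 1) ∧
    ∀ i < τ.2.1 + τ.2.2, c.trackLetter τ (i + 1) = 0 ∨
      c.LetterStep (c.trackLetter τ i) (c.trackLetter τ (i + 1))) ∧
    ∃ i < τ.2.1 + τ.2.2, c.trackLetter τ i = 0

/-- The coded track is a path. -/
def IsPathCode (c : KripkeCode) (τ : ℕ × ℕ × ℕ) : Prop :=
  c.trackLetter τ 0 = c.2.1 + 1 ∧
    ∀ i < τ.2.1 + τ.2.2, c.LetterStep (c.trackLetter τ i) (c.trackLetter τ (i + 1))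

/-- The atomic formula `P_a(x)` on codes. -/
def LabelAtom (c : KripkeCode) (a k l : ℕ) (ρ : List (ℕ × ℕ × ℕ × ℕ)) : Prop :=
  (c.letter ρ k 0 = 0 → a ∈ c.2.2) ∧
    ∀ i < l, ¬c.letter ρ k i = 0 → c.letter ρ k (i + 1) = 0 →
      a ∈ (c.1.getD (c.letter ρ k i - 1) default).2

/-- The atomic formula `x < y` on codes. -/
def PrefixAtom (c : KripkeCode) (k k' l : ℕ) (ρ : List (ℕ × ℕ × ℕ × ℕ)) : Prop :=
  ∀ i < l, c.letter ρ k i = 0 ∨ c.letter ρ k i = c.letter ρ k' i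

/-- The atomic formula `x = y` on codes. -/
def EqAtom (c : KripkeCode) (k k' l : ℕ) (ρ : List (ℕ × ℕ × ℕ × ℕ)) : Prop :=
  ∀ i < l, c.letter ρ k i = c.letter ρ k' i

/-- The atomic formula `E(x, y)` on codes. -/
def LevelAtom (c : KripkeCode) (k k' l : ℕ) (ρ : List (ℕ × ℕ × ℕ × ℕ)) : Prop :=
  ∀ i < l, (c.letter ρ k i = 0 ↔ c.letter ρ k' i = 0)

/-- The number of periods of the valuation that precede the period of a track over which a formula
with Gödel number `n` quantifies. -/
def newBound (c : KripkeCode) (n : ℕ) : ℕ := MPLFormula.classBound c.numLetters n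

/-- The start of the period of a new track. -/
def newStart (c : KripkeCode) (n N P : ℕ) : ℕ := N + c.newBound n * P

/-- The period of a new track. -/
def newPeriod (c : KripkeCode) (n P : ℕ) : ℕ := (c.newBound n).factorial * P

/-- Satisfaction on codes; `P` is a common period of all tracks from position `N` on. -/
def CodeSat (c : KripkeCode) : MPLFormula ℕ → ℕ → ℕ → List (ℕ × ℕ × ℕ × ℕ) → Prop
  | .prop a x, N, P, ρ => c.LabelAtom a (2 * x) (N + P) ρ
  | .lt x y, N, P, ρ => c.PrefixAtom (2 * x) (2 * y) (N + P) ρ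
  | .eq x y, N, P, ρ => c.EqAtom (2 * x) (2 * y) (N + P) ρ
  | .mem x X, N, P, ρ =>
      ¬c.letter ρ (2 * X + 1) 0 = 0 ∧ c.PrefixAtom (2 * x) (2 * X + 1) (N + P) ρ
  | .eqLevel x y, N, P, ρ => c.LevelAtom (2 * x) (2 * y) (N + P) ρ
  | .neg φ, N, P, ρ => ¬c.CodeSat φ N P ρ
  | .or φ ψ, N, P, ρ => c.CodeSat φ N P ρ ∨ c.CodeSat ψ N P ρ
  | .exFO x φ, N, P, ρ =>
      let n := (MPLFormula.exFO x φ).toNat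
      ∃ m < c.numLetters ^ (c.newStart n N P + c.newPeriod n P),
        c.IsNodeCode (m, c.newStart n N P, c.newPeriod n P) ∧
        c.CodeSat φ (c.newStart n N P) (c.newPeriod n P)
          ((2 * x, m, c.newStart n N P, c.newPeriod n P) :: ρ)
  | .exSO X φ, N, P, ρ =>
      let n := (MPLFormula.exSO X φ).toNat
      ∃ m < c.numLetters ^ (c.newStart n N P + c.newPeriod n P),
        c.IsPathCode (m, c.newStart n N P, c.newPeriod n P) ∧
        c.CodeSat φ (c.newStart n N P) (c.newPeriod n P)
          ((2 * X + 1, m, c.newStart n N P, c.newPeriod n P) :: ρ)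

/-! ### Correctness of the evaluation -/

theorem numLetters_pos (c : KripkeCode) : 0 < c.numLetters := Nat.succ_pos _

theorem trackLetter_lt (c : KripkeCode) (τ : ℕ × ℕ × ℕ) (i : ℕ) :
    c.trackLetter τ i < c.numLetters :=
  Nat.mod_lt _ c.numLetters_pos

theorem letter_lt (c : KripkeCode) (ρ : List (ℕ × ℕ × ℕ × ℕ)) (k i : ℕ) :
    c.letter ρ k i < c.numLetters := by
  induction ρ with
  | nil => exact c.numLetters_pos
  | cons e ρ ih =>
    simp only [letter, List.foldr_cons]
    split_ifs
    · exact c.trackLetter_lt _ _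
    · exact ih

theorem letter_cons (c : KripkeCode) (ρ : List (ℕ × ℕ × ℕ × ℕ)) (e : ℕ × ℕ × ℕ × ℕ) (k i : ℕ) :
    c.letter (e :: ρ) k i = if e.1 = k then c.trackLetter e.2 i else c.letter ρ k i := rfl

theorem reducePos_lt {N P : ℕ} (hP : 0 < P) (i : ℕ) : reducePos N P i < N + P := by
  unfold reducePos
  split_ifs
  · omega
  · have := Nat.mod_lt (i - N) hP
    omega

theorem reducePos_add {N P i : ℕ} (hi : N ≤ i) : reducePos N P (i + P) = reducePos N P i := by
  unfold reducePos
  rw [if_neg (by omega), if_neg (by omega), Nat.sub_add_comm hi, Nat.add_mod_right]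

theorem evPeriodic_reducePos {A : Type*} {N P : ℕ} {α : ℕ → A} (h : EvPeriodic N P α) (i : ℕ) :
    α (reducePos N P i) = α i := by
  unfold reducePos
  split_ifs with hi
  · rfl
  · rw [← h.mul ((i - N) / P) _ (by omega), Nat.add_assoc, Nat.mod_add_div']
    congr 1; omega

theorem evPeriodic_trackLetter (c : KripkeCode) (m N P : ℕ) :
    EvPeriodic N P (c.trackLetter (m, N, P)) := fun i hi => by
  simp only [trackLetter, reducePos_add hi]

theorem exists_digits {B : ℕ} (l : ℕ) (f : ℕ → ℕ) (hf : ∀ i, f i < B) :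
    ∃ m < B ^ l, ∀ i < l, m / B ^ i % B = f i := by
  have hB : 0 < B := (Nat.zero_le _).trans_lt (hf 0)
  induction l generalizing f with
  | zero => exact ⟨0, by simp, by simp⟩
  | succ l ih =>
    obtain ⟨m, hm, h⟩ := ih (fun i => f (i + 1)) fun i => hf _
    refine ⟨f 0 + B * m, ?_, fun i hi => ?_⟩
    · calc f 0 + B * m < B + B * m := Nat.add_lt_add_right (hf 0) _
        _ = B * (m + 1) := by ring
        _ ≤ B * B ^ l := Nat.mul_le_mul_left _ hm
        _ = B ^ (l + 1) := by ring
    · rcases i with _ | i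
      · simp [Nat.mod_eq_of_lt (hf 0)]
      · rw [pow_succ', ← Nat.div_div_eq_div_mul, Nat.add_mul_div_left _ _ hB,
          Nat.div_eq_of_lt (hf 0), Nat.zero_add]
        exact h i (by omega)

theorem exists_trackLetter (c : KripkeCode) {N P : ℕ} (hP : 0 < P) (f : ℕ → ℕ)
    (hf : ∀ i, f i < c.numLetters) (h : EvPeriodic N P f) :
    ∃ m < c.numLetters ^ (N + P), c.trackLetter (m, N, P) = f := by
  obtain ⟨m, hm, hd⟩ := exists_digits (N + P) f hf
  refine ⟨m, hm, funext fun i => ?_⟩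
  simp only [trackLetter]
  rw [hd _ (reducePos_lt hP i), evPeriodic_reducePos h]

/-! ### Letters and codes versus states and tracks. -/

section Decode

variable {S AP : Type*} {c : KripkeCode} {K : KripkeStructure S AP} {e : S ≃ Fin c.1.length}
  {ν : AP ↪ ℕ}

/-- The state denoted by a letter. -/
def decodeLetter (e : S ≃ Fin c.1.length) (d : ℕ) : Option S :=
  if h : 0 < d ∧ d - 1 < c.1.length then some (e.symm ⟨d - 1, h.2⟩) else none

@[simp] theorem decodeLetter_zero : decodeLetter e 0 = none := by
  simp [decodeLetter]

theorem decodeLetter_succ (s : S) : decodeLetter e (e s + 1) = some s := by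
  simp [decodeLetter]

theorem eq_zero_or_exists {d : ℕ} (hd : d < c.numLetters) : d = 0 ∨ ∃ s, d = e s + 1 := by
  rcases Nat.eq_zero_or_pos d with h | h
  · exact .inl h
  · have hlt : d - 1 < c.1.length := by unfold numLetters at hd; omega
    exact .inr ⟨e.symm ⟨d - 1, hlt⟩, by simp; omega⟩

theorem decodeLetter_eq_none_iff {d : ℕ} (hd : d < c.numLetters) :
    decodeLetter e d = none ↔ d = 0 := by
  rcases eq_zero_or_exists (e := e) hd with rfl | ⟨s, rfl⟩
  · simp
  · simp [decodeLetter_succ]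

theorem decodeLetter_eq_some_iff {d : ℕ} (s : S) : decodeLetter e d = some s ↔ d = e s + 1 := by
  constructor
  · intro h
    unfold decodeLetter at h
    split_ifs at h with hd
    rw [Option.some_inj] at h
    rw [← h]
    simp; omega
  · rintro rfl
    exact decodeLetter_succ s

theorem decodeLetter_inj {d d' : ℕ} (hd : d < c.numLetters) (hd' : d' < c.numLetters) :
    decodeLetter e d = decodeLetter e d' ↔ d = d' := by
  rcases eq_zero_or_exists (e := e) hd' with rfl | ⟨s, rfl⟩
  · rw [decodeLetter_zero, decodeLetter_eq_none_iff hd]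
  · rw [decodeLetter_succ, decodeLetter_eq_some_iff]

/-- The letter that denotes a state. -/
def encodeLetter (e : S ≃ Fin c.1.length) : Option S → ℕ
  | none => 0
  | some s => e s + 1

theorem encodeLetter_lt (o : Option S) : encodeLetter e o < c.numLetters := by
  unfold numLetters
  rcases o with _ | s
  · exact Nat.succ_pos _
  · exact Nat.succ_lt_succ (e s).2

theorem decodeLetter_encodeLetter (o : Option S) : decodeLetter e (encodeLetter e o) = o := by
  rcases o with _ | s
  · exact decodeLetter_zero
  · exact decodeLetter_succ s

theorem letterStep_iff (hD : c.Describes K e ν) (d d' : ℕ) (hd : d < c.numLetters)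
    (hd' : d' < c.numLetters) : c.LetterStep d d' ↔ K.Step (decodeLetter e d) (decodeLetter e d') := by
  simp only [LetterStep, KripkeStructure.Step, decodeLetter_eq_some_iff]
  rcases eq_zero_or_exists (e := e) hd with rfl | ⟨s, rfl⟩
  · simp
  rcases eq_zero_or_exists (e := e) hd' with rfl | ⟨t, rfl⟩
  · simp
  have := hD.mem_δ s t
  simp only [Nat.add_right_cancel_iff, Fin.val_inj, e.apply_eq_iff_eq]
  simp [this]

theorem letter_eq_init_iff (hD : c.Describes K e ν) (d : ℕ) :
    d = c.2.1 + 1 ↔ decodeLetter e d = some K.init := by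
  rw [decodeLetter_eq_some_iff, hD.init]

/-- The conditions at `i` involve only the letters at `i` and `i + 1`, so they are periodic from `N`
on, and checking positions below `N + P` suffices. -/
theorem isNodeCode_iff (hD : c.Describes K e ν) (m N P : ℕ) (hP : 0 < P) :
    c.IsNodeCode (m, N, P) ↔
      K.IsNodeTrack fun i => decodeLetter e (c.trackLetter (m, N, P) i) := by
  have hper := c.evPeriodic_trackLetter m N P
  simp only [IsNodeCode, KripkeStructure.IsNodeTrack]
  rw [← forall_iff_forall_lt hP, ← exists_iff_exists_lt hP, letter_eq_init_iff hD]
  · simp only [decodeLetter_eq_none_iff (c.trackLetter_lt _ _),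
      letterStep_iff hD _ _ (c.trackLetter_lt _ _) (c.trackLetter_lt _ _)]
  · intro i hi
    simp only [hper i hi]
  · intro i hi
    simp only [hper i hi, Nat.add_right_comm i P 1, hper (i + 1) (by omega)]

theorem isPathCode_iff (hD : c.Describes K e ν) (m N P : ℕ) (hP : 0 < P) :
    c.IsPathCode (m, N, P) ↔
      K.IsPathTrack fun i => decodeLetter e (c.trackLetter (m, N, P) i) := by
  have hper := c.evPeriodic_trackLetter m N P
  simp only [IsPathCode, KripkeStructure.IsPathTrack]
  rw [← forall_iff_forall_lt hP, letter_eq_init_iff hD]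
  · simp only [letterStep_iff hD _ _ (c.trackLetter_lt _ _) (c.trackLetter_lt _ _)]
  · intro i hi
    simp only [hper i hi, Nat.add_right_comm i P 1, hper (i + 1) (by omega)]

theorem setTrack_decodeLetter (ρ : List (ℕ × ℕ × ℕ × ℕ)) (k m N P : ℕ) :
    MPLFormula.setTrack k (fun i => decodeLetter e (c.trackLetter (m, N, P) i))
        (fun i j => decodeLetter e (c.letter ρ j i)) =
      fun i j => decodeLetter e (c.letter ((k, m, N, P) :: ρ) j i) := by
  funext i j
  simp only [MPLFormula.setTrack, letter_cons]
  by_cases h : j = k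
  · subst h; simp
  · rw [Function.update_of_ne h, if_neg (Ne.symm h)]

/-- The new start and period are chosen later than the old start and divisible by the old period, so
the older tracks share them with the added one. -/
theorem evPeriodic_letter_cons {ρ : List (ℕ × ℕ × ℕ × ℕ)} {N P N' P' : ℕ}
    (hρ : EvPeriodic N P fun i k => c.letter ρ k i) (hN : N ≤ N') (hP : P ∣ P') (k m : ℕ) :
    EvPeriodic N' P' fun i j => c.letter ((k, m, N', P') :: ρ) j i := by
  intro i hi
  funext j
  simp only [letter_cons]
  split_ifs
  · exact c.evPeriodic_trackLetter m N' P' i hi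
  · exact congrFun (hρ.of_dvd hN hP i hi) j

theorem numLetters_eq_card (e : S ≃ Fin c.1.length) : c.numLetters = Nat.card (Option S) := by
  have : Finite S := Finite.of_equiv _ e.symm
  rw [Finite.card_option, Nat.card_congr e, Nat.card_fin, numLetters]

/-- A quantifier over tracks can be replaced by a bounded quantifier over codes. -/
theorem exists_code_iff {Q : (ℕ → Option S) → Prop} {L : Set (ℕ → ℕ → Option S)} {k n N P : ℕ}
    (hQ : Recognizable (c.numLetters * c.numLetters * (c.numLetters * c.numLetters) * 2 *
      (c.numLetters * c.numLetters * (c.numLetters * c.numLetters) * 2))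
      {α : ℕ → ℕ → Option S | Q fun i => α i k}) {n' : ℕ}
    (hL : Recognizable (MPLFormula.classBound c.numLetters n') L) (hn : n' < n) (hN : 0 < N)
    (hP : 0 < P) {ρ : List (ℕ × ℕ × ℕ × ℕ)} (hρ : EvPeriodic N P fun i k => c.letter ρ k i) :
    (∃ m < c.numLetters ^ (c.newStart n N P + c.newPeriod n P),
      (Q fun i => decodeLetter e (c.trackLetter (m, c.newStart n N P, c.newPeriod n P) i)) ∧
      (fun i j => decodeLetter e
        (c.letter ((k, m, c.newStart n N P, c.newPeriod n P) :: ρ) j i)) ∈ L) ↔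
    ∃ τ, Q τ ∧ MPLFormula.setTrack k τ (fun i j => decodeLetter e (c.letter ρ j i)) ∈ L := by
  constructor
  · rintro ⟨m, -, hm, h⟩
    rw [← setTrack_decodeLetter] at h
    exact ⟨_, hm, h⟩
  · intro h
    -- Pumping is applied before projection, to the body together with the track condition. Since
    -- `n' < n`, the bound at `n` already covers this intersection.
    have hM : Recognizable (c.newBound n) ({α : ℕ → ℕ → Option S | Q fun i => α i k} ∩ L) :=
      (hQ.inter hL).mono ((MPLFormula.body_le_classBound_succ n' c.numLetters_pos).trans
        (MPLFormula.classBound_mono c.numLetters_pos hn))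
    obtain ⟨τ, hτ, hL', hper⟩ := MPLFormula.exists_evPeriodic_track hM hN hP (α := fun i j =>
      decodeLetter e (c.letter ρ j i)) (fun i hi => by
        funext j
        exact congrArg (decodeLetter e) (congrFun (hρ i hi) j)) h
    -- A track with this start and period is determined by its first start-plus-period letters,
    -- which are the digits of a number below the search bound.
    obtain ⟨m, hm, hc⟩ := c.exists_trackLetter (N := c.newStart n N P) (P := c.newPeriod n P)
      (Nat.mul_pos (Nat.factorial_pos _) hP) (fun i => encodeLetter e (τ i))
      (fun i => encodeLetter_lt _) (fun i hi => congrArg (encodeLetter e) (hper i hi))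
    have hτ' : (fun i => decodeLetter e
        (c.trackLetter (m, c.newStart n N P, c.newPeriod n P) i)) = τ := by
      funext i
      rw [hc, decodeLetter_encodeLetter]
    refine ⟨m, hm, by rwa [hτ'], ?_⟩
    rwa [← setTrack_decodeLetter, hτ']

/-- Induction on the formula with `N`, `P` and `ρ` varying: each quantifier passes the larger start
and period to its body. For atoms, periodicity turns the bounded checks into statements about all
positions. -/
theorem codeSat_iff (hD : c.Describes K e ν) (φ : MPLFormula AP) (N P : ℕ) (hN : 0 < N)
    (hP : 0 < P) (ρ : List (ℕ × ℕ × ℕ × ℕ)) (hρ : EvPeriodic N P fun i k => c.letter ρ k i) :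
    c.CodeSat (φ.map ν) N P ρ ↔ φ.WordSat K fun i k => decodeLetter e (c.letter ρ k i) := by
  have hfin : Finite S := Finite.of_equiv _ e.symm
  have hB := numLetters_eq_card e
  have hlt := c.letter_lt ρ
  have hρ' : ∀ i, N ≤ i → ∀ k, c.letter ρ k (i + P) = c.letter ρ k i :=
    fun i hi k => congrFun (hρ i hi) k
  induction φ generalizing N P ρ with
  | prop a x =>
    simp only [MPLFormula.map, CodeSat, LabelAtom, MPLFormula.WordSat]
    rw [← forall_iff_forall_lt hP]
    · simp only [decodeLetter_eq_none_iff (hlt _ _), decodeLetter_eq_some_iff, hD.mem_L_nil]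
      refine and_congr Iff.rfl (forall_congr' fun i => ?_)
      rcases eq_zero_or_exists (e := e) (hlt (2 * x) i) with h | ⟨s, h⟩
      · simp [h]
      · have hs := hD.mem_L [] s a
        simp only [List.nil_append] at hs
        rw [h]
        simp only [Nat.add_right_cancel_iff, Fin.val_inj, e.apply_eq_iff_eq, forall_eq', hs]
        simp
    · intro i hi
      simp only [hρ' i hi, Nat.add_right_comm i P 1, hρ' (i + 1) (by omega)]
  | lt x y =>
    simp only [MPLFormula.map, CodeSat, PrefixAtom, MPLFormula.WordSat]
    rw [← forall_iff_forall_lt hP fun i hi => by simp only [hρ' i hi]]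
    simp only [decodeLetter_eq_none_iff (hlt _ _), decodeLetter_inj (hlt _ _) (hlt _ _)]
  | eq x y =>
    simp only [MPLFormula.map, CodeSat, EqAtom, MPLFormula.WordSat]
    rw [← forall_iff_forall_lt hP fun i hi => by simp only [hρ' i hi]]
    simp only [decodeLetter_inj (hlt _ _) (hlt _ _)]
  | mem x X =>
    simp only [MPLFormula.map, CodeSat, PrefixAtom, MPLFormula.WordSat]
    rw [← forall_iff_forall_lt hP fun i hi => by simp only [hρ' i hi]]
    simp only [decodeLetter_eq_none_iff (hlt _ _), decodeLetter_inj (hlt _ _) (hlt _ _), ne_eq]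
  | eqLevel x y =>
    simp only [MPLFormula.map, CodeSat, LevelAtom, MPLFormula.WordSat]
    rw [← forall_iff_forall_lt hP fun i hi => by simp only [hρ' i hi]]
    simp only [decodeLetter_eq_none_iff (hlt _ _)]
  | neg φ ih =>
    simp only [MPLFormula.map, CodeSat, MPLFormula.WordSat, ih N P hN hP ρ hρ hlt hρ']
  | or φ ψ ih ih' =>
    simp only [MPLFormula.map, CodeSat, MPLFormula.WordSat, ih N P hN hP ρ hρ hlt hρ',
      ih' N P hN hP ρ hρ hlt hρ']
  | exFO x φ ih =>
    have hn : (φ.map ν).toNat < ((MPLFormula.exFO x φ).map ν).toNat := by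
      have := Nat.right_le_pair x (φ.map ν).toNat
      simp only [MPLFormula.map, MPLFormula.toNat]; omega
    have key := exists_code_iff (e := e)
      (hQ := MPLFormula.recognizable_isNodeTrack K (2 * x) hB)
      (hL := MPLFormula.recognizable_wordSat K ν φ hB) hn hN hP hρ
    refine Iff.trans ?_ key
    refine exists_congr fun m => and_congr_right fun _ => ?_
    have hP' : 0 < c.newPeriod ((MPLFormula.exFO x φ).map ν).toNat P :=
      Nat.mul_pos (Nat.factorial_pos _) hP
    have hρc := evPeriodic_letter_cons hρ (N' := c.newStart ((MPLFormula.exFO x φ).map ν).toNat N P)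
      (Nat.le_add_right _ _) (Nat.dvd_mul_left P
        (c.newBound ((MPLFormula.exFO x φ).map ν).toNat).factorial) (2 * x) m
    exact and_congr (isNodeCode_iff hD _ _ _ hP')
      (ih _ _ (Nat.add_pos_left hN _) hP' _ hρc (c.letter_lt _)
        fun i hi k => congrFun (hρc i hi) k)
  | exSO X φ ih =>
    have hn : (φ.map ν).toNat < ((MPLFormula.exSO X φ).map ν).toNat := by
      have := Nat.right_le_pair X (φ.map ν).toNat
      simp only [MPLFormula.map, MPLFormula.toNat]; omega
    have key := exists_code_iff (e := e)
      (hQ := MPLFormula.recognizable_isPathTrack K (2 * X + 1) hB)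
      (hL := MPLFormula.recognizable_wordSat K ν φ hB) hn hN hP hρ
    refine Iff.trans ?_ key
    refine exists_congr fun m => and_congr_right fun _ => ?_
    have hP' : 0 < c.newPeriod ((MPLFormula.exSO X φ).map ν).toNat P :=
      Nat.mul_pos (Nat.factorial_pos _) hP
    have hρc := evPeriodic_letter_cons hρ (N' := c.newStart ((MPLFormula.exSO X φ).map ν).toNat N P)
      (Nat.le_add_right _ _) (Nat.dvd_mul_left P
        (c.newBound ((MPLFormula.exSO X φ).map ν).toNat).factorial) (2 * X + 1) m
    exact and_congr (isPathCode_iff hD _ _ _ hP')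
      (ih _ _ (Nat.add_pos_left hN _) hP' _ hρc (c.letter_lt _)
        fun i hi k => congrFun (hρc i hi) k)

theorem codeSat_iff_models (hD : c.Describes K e ν)
    (hK : ∀ (v w : List S) (s : S), K.L (v ++ [s]) = K.L (w ++ [s]))
    (φ : MPLFormula AP) : c.CodeSat (φ.map ν) 1 1 [] ↔ φ.Models K := by
  -- With no track set, every letter is 0, so the period may be 1. The start is 1 rather than 0
  -- because pumping needs a nonempty initial segment.
  rw [MPLFormula.models_iff_wordSat hK, codeSat_iff hD φ 1 1 one_pos one_pos [] fun i _ => rfl]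
  rfl

end Decode

theorem exists_list_mem_iff {X : Type*} [Finite X] (f : X ↪ ℕ) (s : Set X) :
    ∃ l : List ℕ, ∀ x, x ∈ s ↔ f x ∈ l :=
  ⟨((s.toFinite.image f).toFinset).toList, fun x => by simp⟩

/-- Every finite Kripke structure has a description. -/
theorem exists_describes {S AP : Type*} {K : KripkeStructure S AP} (hK : K.IsFinite) :
    ∃ (c : KripkeCode) (e : S ≃ Fin c.1.length) (ν : AP ↪ ℕ), c.Describes K e ν := by
  obtain ⟨hS, hAP, hL⟩ := hK
  obtain ⟨n, ⟨e⟩⟩ := Finite.exists_equiv_fin S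
  obtain ⟨k, ⟨ν'⟩⟩ := Finite.exists_equiv_fin AP
  let ν : AP ↪ ℕ := ν'.toEmbedding.trans Fin.valEmbedding
  choose succs hsuccs using fun s =>
    exists_list_mem_iff (e.toEmbedding.trans Fin.valEmbedding) (K.δ s)
  choose labels hlabels using fun s : S => exists_list_mem_iff ν (K.L [s])
  obtain ⟨l, hl⟩ := exists_list_mem_iff ν (K.L [])
  let T : List (List ℕ × List ℕ) :=
    List.ofFn fun i : Fin n => (succs (e.symm i), labels (e.symm i))
  have hT : n = T.length := by simp [T]
  have hget : ∀ s, T.get (finCongr hT (e s)) = (succs s, labels s) := by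
    intro s
    simp [T]
  refine ⟨(T, e K.init, l), e.trans (finCongr hT), ν, rfl, ?_, ?_, hl⟩
  · intro s t
    have := hget s
    simp only [Equiv.trans_apply] at this ⊢
    rw [this]
    exact hsuccs s t
  · intro w s a
    have := hget s
    simp only [Equiv.trans_apply] at this ⊢
    rw [this, hL w [] s]
    exact hlabels s a

end KripkeCode

/-! ### Computability of the evaluation -/

namespace PrimrecPred

variable {α β : Type*} [Primcodable α] [Primcodable β]

theorem forall_lt_of_rel {R : α → ℕ → Prop} {f : α → ℕ} (hf : Primrec f) (hR : PrimrecRel R) :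
    PrimrecPred fun a => ∀ i < f a, R a i :=
  ((PrimrecRel.forall_mem_list hR.swap).comp (Primrec.list_range.comp hf) Primrec.id).of_eq
    fun a => by simp

theorem exists_lt_of_rel {R : α → ℕ → Prop} {f : α → ℕ} (hf : Primrec f) (hR : PrimrecRel R) :
    PrimrecPred fun a => ∃ i < f a, R a i :=
  ((PrimrecRel.exists_mem_list hR.swap).comp (Primrec.list_range.comp hf) Primrec.id).of_eq
    fun a => by simp

theorem imp {p q : α → Prop} (hp : PrimrecPred p) (hq : PrimrecPred q) :
    PrimrecPred fun a => p a → q a :=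
  (hp.not.or hq).of_eq fun a => by tauto

theorem iff {p q : α → Prop} (hp : PrimrecPred p) (hq : PrimrecPred q) :
    PrimrecPred fun a => p a ↔ q a :=
  ((hp.imp hq).and (hq.imp hp)).of_eq fun a => by tauto

theorem mem_list {f : α → β} {l : α → List β} (hf : Primrec f) (hl : Primrec l) :
    PrimrecPred fun a => f a ∈ l a :=
  ((PrimrecRel.exists_mem_list (Primrec.eq (α := β))).comp hl hf).of_eq fun a => by simp

end PrimrecPred

namespace Primrec

variable {α : Type*} [Primcodable α]

theorem nat_pow : Primrec₂ ((· ^ ·) : ℕ → ℕ → ℕ) :=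
  Primrec₂.unpaired'.1 Nat.Primrec.pow

theorem nat_factorial : Primrec Nat.factorial :=
  (nat_rec' (f := id) (g := fun _ => 1) (h := fun _ p => (p.1 + 1) * p.2) Primrec.id (const 1)
    (nat_mul.comp (succ.comp (fst.comp snd)) (snd.comp snd)).to₂).of_eq fun n => by
      induction n with
      | zero => rfl
      | succ n ih => exact congrArg ((n + 1) * ·) ih

theorem classBound : Primrec₂ MPLFormula.classBound := by
  have sq : Primrec fun B : ℕ => B * B * (B * B) * 2 :=
    nat_mul.comp (nat_mul.comp (nat_mul.comp .id .id) (nat_mul.comp .id .id)) (const 2)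
  have step : Primrec₂ fun (B : ℕ) (p : ℕ × ℕ) =>
      2 ^ (B * B * (B * B) * 2 * (B * B * (B * B) * 2) * (p.2 * p.2)) :=
    nat_pow.comp (const 2) (nat_mul.comp (nat_mul.comp (sq.comp fst) (sq.comp fst))
      (nat_mul.comp (snd.comp snd) (snd.comp snd)))
  refine (nat_rec sq step).of_eq fun B n => ?_
  induction n with
  | zero => rfl
  | succ n ih => simp only [MPLFormula.classBound, ← ih]

end Primrec

/-! ### Primitive recursive predicates on codes. -/

namespace KripkeCode

open Primrec

variable {α : Type*} [Primcodable α] {c : α → KripkeCode} {ρ : α → List (ℕ × ℕ × ℕ × ℕ)}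
  {τ : α → ℕ × ℕ × ℕ} {i k k' l n N P : α → ℕ}

theorem primrec_numLetters (hc : Primrec c) : Primrec fun x => (c x).numLetters :=
  succ.comp (list_length.comp (fst.comp hc))

theorem primrec_trackLetter (hc : Primrec c) (hτ : Primrec τ) (hi : Primrec i) :
    Primrec fun x => (c x).trackLetter (τ x) (i x) := by
  have hN : Primrec fun x => (τ x).2.1 := fst.comp (snd.comp hτ)
  have hP : Primrec fun x => (τ x).2.2 := snd.comp (snd.comp hτ)
  have hred : Primrec fun x => reducePos (τ x).2.1 (τ x).2.2 (i x) :=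
    Primrec.ite (nat_lt.comp hi hN) hi (nat_add.comp hN (nat_mod.comp (nat_sub.comp hi hN) hP))
  exact nat_mod.comp (nat_div.comp (fst.comp hτ) (nat_pow.comp (primrec_numLetters hc) hred))
    (primrec_numLetters hc)

theorem primrec_letter (hc : Primrec c) (hρ : Primrec ρ) (hk : Primrec k) (hi : Primrec i) :
    Primrec fun x => (c x).letter (ρ x) (k x) (i x) :=
  list_foldr hρ (const 0)
    (h := fun x (p : (ℕ × ℕ × ℕ × ℕ) × ℕ) =>
      if p.1.1 = k x then (c x).trackLetter p.1.2 (i x) else p.2)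
    (Primrec.ite (Primrec.eq.comp (fst.comp (fst.comp snd)) (hk.comp fst))
      (primrec_trackLetter (hc.comp fst) (snd.comp (fst.comp snd)) (hi.comp fst))
      (snd.comp snd)).to₂

theorem primrec_stateRow (hc : Primrec c) (hi : Primrec i) :
    Primrec fun x => (c x).1.getD (i x - 1) default :=
  (list_getD default).comp (fst.comp hc) (nat_sub.comp hi (const 1))

theorem primrecPred_letterStep (hc : Primrec c) (hk : Primrec k) (hi : Primrec i) :
    PrimrecPred fun x => (c x).LetterStep (k x) (i x) :=
  (nat_lt.comp (const 0) hk).and ((nat_lt.comp (const 0) hi).and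
    (.mem_list (nat_sub.comp hi (const 1)) (fst.comp (primrec_stateRow hc hk))))

theorem primrecPred_isNodeCode (hc : Primrec c) (hτ : Primrec τ) :
    PrimrecPred fun x => (c x).IsNodeCode (τ x) := by
  have hl : Primrec fun x => (τ x).2.1 + (τ x).2.2 :=
    nat_add.comp (fst.comp (snd.comp hτ)) (snd.comp (snd.comp hτ))
  have h0 := primrec_trackLetter hc hτ (const 0)
  have h : Primrec fun p : α × ℕ => (c p.1).trackLetter (τ p.1) p.2 :=
    primrec_trackLetter (hc.comp fst) (hτ.comp fst) snd
  have h' : Primrec fun p : α × ℕ => (c p.1).trackLetter (τ p.1) (p.2 + 1) :=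
    primrec_trackLetter (hc.comp fst) (hτ.comp fst) (succ.comp snd)
  have hinit : Primrec fun x => (c x).2.1 + 1 := succ.comp (fst.comp (snd.comp hc))
  exact (((Primrec.eq.comp h0 (const 0)).or (Primrec.eq.comp h0 hinit)).and
    (.forall_lt_of_rel hl (PrimrecPred.primrecRel ((Primrec.eq.comp h' (const 0)).or
      (primrecPred_letterStep (hc.comp fst) h h'))))).and
    (.exists_lt_of_rel hl (Primrec.eq.comp h (const 0)))

theorem primrecPred_isPathCode (hc : Primrec c) (hτ : Primrec τ) :
    PrimrecPred fun x => (c x).IsPathCode (τ x) := by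
  have hl : Primrec fun x => (τ x).2.1 + (τ x).2.2 :=
    nat_add.comp (fst.comp (snd.comp hτ)) (snd.comp (snd.comp hτ))
  have h0 := primrec_trackLetter hc hτ (const 0)
  have h : Primrec fun p : α × ℕ => (c p.1).trackLetter (τ p.1) p.2 :=
    primrec_trackLetter (hc.comp fst) (hτ.comp fst) snd
  have h' : Primrec fun p : α × ℕ => (c p.1).trackLetter (τ p.1) (p.2 + 1) :=
    primrec_trackLetter (hc.comp fst) (hτ.comp fst) (succ.comp snd)
  have hinit : Primrec fun x => (c x).2.1 + 1 := succ.comp (fst.comp (snd.comp hc))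
  exact (Primrec.eq.comp h0 hinit).and
    (.forall_lt_of_rel hl (primrecPred_letterStep (hc.comp fst) h h'))

theorem primrecPred_labelAtom (hc : Primrec c) (hn : Primrec n) (hk : Primrec k) (hl : Primrec l)
    (hρ : Primrec ρ) : PrimrecPred fun x => (c x).LabelAtom (n x) (k x) (l x) (ρ x) := by
  have h0 := primrec_letter hc hρ hk (const 0)
  have h : Primrec fun p : α × ℕ => (c p.1).letter (ρ p.1) (k p.1) p.2 :=
    primrec_letter (hc.comp fst) (hρ.comp fst) (hk.comp fst) snd
  have h' : Primrec fun p : α × ℕ => (c p.1).letter (ρ p.1) (k p.1) (p.2 + 1) :=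
    primrec_letter (hc.comp fst) (hρ.comp fst) (hk.comp fst) (succ.comp snd)
  exact ((Primrec.eq.comp h0 (const 0)).imp (.mem_list hn (snd.comp (snd.comp hc)))).and
    (.forall_lt_of_rel hl ((Primrec.eq.comp h (const 0)).not.imp
      ((Primrec.eq.comp h' (const 0)).imp
        (.mem_list (hn.comp fst) (snd.comp (primrec_stateRow (hc.comp fst) h))))))

theorem primrecPred_prefixAtom (hc : Primrec c) (hk : Primrec k) (hk' : Primrec k')
    (hl : Primrec l) (hρ : Primrec ρ) :
    PrimrecPred fun x => (c x).PrefixAtom (k x) (k' x) (l x) (ρ x) := by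
  have h : Primrec fun p : α × ℕ => (c p.1).letter (ρ p.1) (k p.1) p.2 :=
    primrec_letter (hc.comp fst) (hρ.comp fst) (hk.comp fst) snd
  have h' : Primrec fun p : α × ℕ => (c p.1).letter (ρ p.1) (k' p.1) p.2 :=
    primrec_letter (hc.comp fst) (hρ.comp fst) (hk'.comp fst) snd
  exact .forall_lt_of_rel hl ((Primrec.eq.comp h (const 0)).or (Primrec.eq.comp h h'))

theorem primrecPred_eqAtom (hc : Primrec c) (hk : Primrec k) (hk' : Primrec k')
    (hl : Primrec l) (hρ : Primrec ρ) :
    PrimrecPred fun x => (c x).EqAtom (k x) (k' x) (l x) (ρ x) := by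
  have h : Primrec fun p : α × ℕ => (c p.1).letter (ρ p.1) (k p.1) p.2 :=
    primrec_letter (hc.comp fst) (hρ.comp fst) (hk.comp fst) snd
  have h' : Primrec fun p : α × ℕ => (c p.1).letter (ρ p.1) (k' p.1) p.2 :=
    primrec_letter (hc.comp fst) (hρ.comp fst) (hk'.comp fst) snd
  exact .forall_lt_of_rel hl (Primrec.eq.comp h h')

theorem primrecPred_levelAtom (hc : Primrec c) (hk : Primrec k) (hk' : Primrec k')
    (hl : Primrec l) (hρ : Primrec ρ) :
    PrimrecPred fun x => (c x).LevelAtom (k x) (k' x) (l x) (ρ x) := by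
  have h : Primrec fun p : α × ℕ => (c p.1).letter (ρ p.1) (k p.1) p.2 :=
    primrec_letter (hc.comp fst) (hρ.comp fst) (hk.comp fst) snd
  have h' : Primrec fun p : α × ℕ => (c p.1).letter (ρ p.1) (k' p.1) p.2 :=
    primrec_letter (hc.comp fst) (hρ.comp fst) (hk'.comp fst) snd
  exact .forall_lt_of_rel hl ((Primrec.eq.comp h (const 0)).iff (Primrec.eq.comp h' (const 0)))

theorem primrec_newStart (hc : Primrec c) (hn : Primrec n) (hN : Primrec N) (hP : Primrec P) :
    Primrec fun x => (c x).newStart (n x) (N x) (P x) :=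
  nat_add.comp hN (nat_mul.comp (Primrec.classBound.comp (primrec_numLetters hc) hn) hP)

theorem primrec_newPeriod (hc : Primrec c) (hn : Primrec n) (hP : Primrec P) :
    Primrec fun x => (c x).newPeriod (n x) (P x) :=
  nat_mul.comp (nat_factorial.comp (Primrec.classBound.comp (primrec_numLetters hc) hn)) hP

/-- An instance of the evaluation problem: a description, the Gödel number of a formula and a
coded valuation. -/
abbrev Query : Type := KripkeCode × ℕ × ℕ × ℕ × List (ℕ × ℕ × ℕ × ℕ)

/-! ### Evaluation as course-of-values recursion on Gödel numbers. -/

namespace Query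

/-- The answer to a query. -/
def Holds (q : Query) : Prop := q.1.CodeSat (MPLFormula.ofNat q.2.1) q.2.2.1 q.2.2.2.1 q.2.2.2.2

/-- The outermost constructor of the formula. -/
def tag (q : Query) : ℕ := q.2.1 % 9

/-- The argument of the outermost constructor, if there is one. -/
def arg (q : Query) : ℕ := q.2.1 / 9

/-- The first of the two arguments of the outermost constructor. -/
def argL (q : Query) : ℕ := q.arg.unpair.1

/-- The second of the two arguments of the outermost constructor. -/
def argR (q : Query) : ℕ := q.arg.unpair.2

/-- The answer to a query about an atomic formula. -/
def HoldsAtom (q : Query) : Prop :=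
  let l := q.2.2.1 + q.2.2.2.1
  let ρ := q.2.2.2.2
  (q.tag = 0 ∧ q.1.LabelAtom q.argL (2 * q.argR) l ρ) ∨
  (q.tag = 1 ∧ q.1.PrefixAtom (2 * q.argL) (2 * q.argR) l ρ) ∨
  (q.tag = 2 ∧ q.1.EqAtom (2 * q.argL) (2 * q.argR) l ρ) ∨
  (q.tag = 3 ∧ ¬q.1.letter ρ (2 * q.argR + 1) 0 = 0 ∧
    q.1.PrefixAtom (2 * q.argL) (2 * q.argR + 1) l ρ) ∨
  (q.tag = 4 ∧ q.1.LevelAtom (2 * q.argL) (2 * q.argR) l ρ)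

/-- The code with digits `m` of a track over which the formula quantifies. -/
def track (q : Query) (m : ℕ) : ℕ × ℕ × ℕ :=
  (m, q.1.newStart q.2.1 q.2.2.1 q.2.2.2.1, q.1.newPeriod q.2.1 q.2.2.2.1)

/-- The number of the track over which the formula quantifies. -/
def trackKey (q : Query) : ℕ := if q.tag = 7 then 2 * q.argL else 2 * q.argL + 1

/-- The code is one of a track over which the formula quantifies. -/
def Admits (q : Query) (m : ℕ) : Prop :=
  (q.tag = 7 ∧ q.1.IsNodeCode (q.track m)) ∨ (¬q.tag = 7 ∧ q.1.IsPathCode (q.track m))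

/-- The query about the body of a quantified formula. -/
def body (q : Query) (m : ℕ) : Query :=
  (q.1, q.argR, (q.track m).2.1, (q.track m).2.2, (q.trackKey, q.track m) :: q.2.2.2.2)

/-- The number of the codes of new tracks. -/
def trackCount (q : Query) : ℕ := q.1.numLetters ^ ((q.track 0).2.1 + (q.track 0).2.2)

open Classical in
/-- The queries about smaller formulas to which a query is reduced. -/
noncomputable def children (q : Query) : List Query :=
  if q.tag < 5 then [] else
  if q.tag = 5 then [(q.1, q.arg, q.2.2)] else
  if q.tag = 6 then [(q.1, q.argL, q.2.2), (q.1, q.argR, q.2.2)] else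
  (List.range q.trackCount).filterMap fun m => if q.Admits m then some (q.body m) else none

open Classical in
/-- The answer to a query, computed from the answers to its children. -/
noncomputable def combine (q : Query) (r : List Bool) : Option Bool :=
  if q.tag < 5 then some (decide q.HoldsAtom) else
  if q.tag = 5 then some (decide (false ∈ r)) else some (decide (true ∈ r))

theorem primrec_tag : Primrec tag := nat_mod.comp (fst.comp snd) (const 9)

theorem primrec_arg : Primrec arg := nat_div.comp (fst.comp snd) (const 9)

theorem primrec_argL : Primrec argL := fst.comp (unpair.comp primrec_arg)

theorem primrec_argR : Primrec argR := snd.comp (unpair.comp primrec_arg)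

theorem primrecPred_holdsAtom : PrimrecPred HoldsAtom := by
  have hρ : Primrec fun q : Query => q.2.2.2.2 := snd.comp (snd.comp (snd.comp snd))
  have hl : Primrec fun q : Query => q.2.2.1 + q.2.2.2.1 :=
    nat_add.comp (fst.comp (snd.comp snd)) (fst.comp (snd.comp (snd.comp snd)))
  have hL : Primrec fun q : Query => 2 * q.argL := nat_mul.comp (const 2) primrec_argL
  have hR : Primrec fun q : Query => 2 * q.argR := nat_mul.comp (const 2) primrec_argR
  have hR' : Primrec fun q : Query => 2 * q.argR + 1 := succ.comp hR
  have ht : ∀ t, PrimrecPred fun q : Query => q.tag = t := fun t =>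
    Primrec.eq.comp primrec_tag (const t)
  exact ((ht 0).and (primrecPred_labelAtom fst primrec_argL hR hl hρ)).or
    (((ht 1).and (primrecPred_prefixAtom fst hL hR hl hρ)).or
    (((ht 2).and (primrecPred_eqAtom fst hL hR hl hρ)).or
    (((ht 3).and ((Primrec.eq.comp (primrec_letter fst hρ hR' (const 0)) (const 0)).not.and
      (primrecPred_prefixAtom fst hL hR' hl hρ))).or
    ((ht 4).and (primrecPred_levelAtom fst hL hR hl hρ)))))

theorem primrec_track : Primrec₂ track := by
  have hn : Primrec fun p : Query × ℕ => p.1.2.1 := fst.comp (snd.comp fst)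
  have hN : Primrec fun p : Query × ℕ => p.1.2.2.1 := fst.comp (snd.comp (snd.comp fst))
  have hP : Primrec fun p : Query × ℕ => p.1.2.2.2.1 :=
    fst.comp (snd.comp (snd.comp (snd.comp fst)))
  exact Primrec.pair snd (Primrec.pair (primrec_newStart (fst.comp fst) hn hN hP)
    (primrec_newPeriod (fst.comp fst) hn hP))

theorem primrec_trackKey : Primrec trackKey := by
  have hL : Primrec fun q : Query => 2 * q.argL := nat_mul.comp (const 2) primrec_argL
  exact Primrec.ite (Primrec.eq.comp primrec_tag (const 7)) hL (succ.comp hL)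

theorem primrecRel_admits : PrimrecRel Admits := by
  have ht : PrimrecPred fun p : Query × ℕ => p.1.tag = 7 :=
    Primrec.eq.comp (primrec_tag.comp fst) (const 7)
  exact (ht.and (primrecPred_isNodeCode (fst.comp fst) primrec_track)).or
    (ht.not.and (primrecPred_isPathCode (fst.comp fst) primrec_track))

theorem primrec_body : Primrec₂ body := by
  have hρ : Primrec fun p : Query × ℕ => p.1.2.2.2.2 :=
    snd.comp (snd.comp (snd.comp (snd.comp fst)))
  exact Primrec.pair (fst.comp fst) (Primrec.pair (primrec_argR.comp fst)
    (Primrec.pair (fst.comp (snd.comp primrec_track))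
      (Primrec.pair (snd.comp (snd.comp primrec_track))
        (list_cons.comp (Primrec.pair (primrec_trackKey.comp fst) primrec_track) hρ))))

theorem primrec_trackCount : Primrec trackCount := by
  have h : Primrec fun q : Query => q.track 0 := primrec_track.comp .id (const 0)
  exact nat_pow.comp (primrec_numLetters fst)
    (nat_add.comp (fst.comp (snd.comp h)) (snd.comp (snd.comp h)))

theorem primrec_children : Primrec children := by
  classical
  have htl : PrimrecPred fun q : Query => q.tag < 5 := nat_lt.comp primrec_tag (const 5)
  have ht : ∀ t, PrimrecPred fun q : Query => q.tag = t := fun t =>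
    Primrec.eq.comp primrec_tag (const t)
  have hq : ∀ {f : Query → ℕ}, Primrec f → Primrec fun q : Query => ((q.1, f q, q.2.2) : Query) :=
    fun hf => Primrec.pair fst (Primrec.pair hf (snd.comp snd))
  refine Primrec.ite htl (const []) (Primrec.ite (ht 5) ?_ (Primrec.ite (ht 6) ?_ ?_))
  · exact list_cons.comp (hq primrec_arg) (const [])
  · exact list_cons.comp (hq primrec_argL) (list_cons.comp (hq primrec_argR) (const []))
  · exact listFilterMap (list_range.comp primrec_trackCount)
      (Primrec.ite primrecRel_admits (option_some.comp primrec_body) (const none)).to₂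

theorem primrec_combine : Primrec₂ combine := by
  classical
  have htl : PrimrecPred fun p : Query × List Bool => p.1.tag < 5 :=
    nat_lt.comp (primrec_tag.comp fst) (const 5)
  have ht : PrimrecPred fun p : Query × List Bool => p.1.tag = 5 :=
    Primrec.eq.comp (primrec_tag.comp fst) (const 5)
  exact Primrec.ite htl (option_some.comp (primrecPred_holdsAtom.decide.comp fst))
    (Primrec.ite ht
      (option_some.comp (PrimrecPred.mem_list (const false) snd).decide)
      (option_some.comp (PrimrecPred.mem_list (const true) snd).decide))

/-- The Gödel number is the termination measure. A query with children has tag at least 5, so its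
number is positive, and dividing by 9 and unpairing then strictly decrease it; the growing start,
period and valuation play no role. -/
theorem lt_of_mem_children (q q' : Query) (h : q' ∈ q.children) : q'.2.1 < q.2.1 := by
  have h₁ := Nat.unpair_left_le (q.2.1 / 9)
  have h₂ := Nat.unpair_right_le (q.2.1 / 9)
  unfold children at h
  split_ifs at h with h5 h6 h7
  · simp at h
  · simp only [List.mem_singleton] at h
    subst h
    simp only [arg, tag] at *
    omega
  · simp only [List.mem_cons, List.not_mem_nil, or_false] at h
    rcases h with rfl | rfl <;> simp only [argL, argR, arg, tag] at * <;> omega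
  · simp only [List.mem_filterMap] at h
    obtain ⟨m, -, hm⟩ := h
    split_ifs at hm
    cases hm
    simp only [body, argR, arg, tag] at *
    omega

theorem holds_toNat (c : KripkeCode) (φ : MPLFormula ℕ) (N P : ℕ)
    (ρ : List (ℕ × ℕ × ℕ × ℕ)) : Holds (c, φ.toNat, N, P, ρ) ↔ c.CodeSat φ N P ρ := by
  simp only [Holds, MPLFormula.ofNat_toNat]

theorem holds_exFO (c : KripkeCode) (x : ℕ) (φ : MPLFormula ℕ) (N P : ℕ)
    (ρ : List (ℕ × ℕ × ℕ × ℕ)) (q : Query) (hq : q = (c, (MPLFormula.exFO x φ).toNat, N, P, ρ)) :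
    q.tag = 7 ∧ (q.Holds ↔ ∃ m < q.trackCount, q.Admits m ∧ (q.body m).Holds) := by
  have ht : q.tag = 7 := by simp [hq, tag, MPLFormula.toNat]
  have hL : q.argL = x := by simp [hq, argL, arg, MPLFormula.toNat, Nat.mul_add_div]
  have hR : q.argR = φ.toNat := by simp [hq, argR, arg, MPLFormula.toNat, Nat.mul_add_div]
  refine ⟨ht, ?_⟩
  simp only [Admits, ht, true_and, not_true_eq_false, false_and, or_false, body, hR, trackKey, hL,
    if_true, holds_toNat]
  subst hq
  rw [holds_toNat]
  rfl

theorem holds_exSO (c : KripkeCode) (X : ℕ) (φ : MPLFormula ℕ) (N P : ℕ)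
    (ρ : List (ℕ × ℕ × ℕ × ℕ)) (q : Query) (hq : q = (c, (MPLFormula.exSO X φ).toNat, N, P, ρ)) :
    q.tag = 8 ∧ (q.Holds ↔ ∃ m < q.trackCount, q.Admits m ∧ (q.body m).Holds) := by
  have ht : q.tag = 8 := by simp [hq, tag, MPLFormula.toNat]
  have hL : q.argL = X := by simp [hq, argL, arg, MPLFormula.toNat, Nat.mul_add_div]
  have hR : q.argR = φ.toNat := by simp [hq, argR, arg, MPLFormula.toNat, Nat.mul_add_div]
  have ht7 : ¬q.tag = 7 := by omega
  refine ⟨ht, ?_⟩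
  simp only [Admits, ht7, false_and, not_false_eq_true, true_and, false_or, body, hR, trackKey, hL,
    if_false, holds_toNat]
  subst hq
  rw [holds_toNat]
  rfl

open Classical in
-- Inadmissible codes are discarded before the recursive calls, so the existential quantifier holds
-- exactly when some child is answered by true. Both kinds of quantifier are covered.
theorem combine_children_of_exists {q : Query} (ht : 6 < q.tag)
    (h : q.Holds ↔ ∃ m < q.trackCount, q.Admits m ∧ (q.body m).Holds) :
    q.combine (q.children.map fun q => decide q.Holds) = some (decide q.Holds) := by
  rw [combine, if_neg (by omega), if_neg (by omega), children, if_neg (by omega),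
    if_neg (by omega), if_neg (by omega), h]
  congr 2
  simp only [List.mem_map, List.mem_filterMap, List.mem_range, Option.ite_none_right_eq_some,
    Option.some_inj, decide_eq_true_eq, eq_iff_iff]
  constructor
  · rintro ⟨_, ⟨m, hm, hA, rfl⟩, hH⟩
    exact ⟨m, hm, hA, hH⟩
  · rintro ⟨m, hm, hA, hH⟩
    exact ⟨_, ⟨m, hm, hA, rfl⟩, hH⟩

open Classical in
-- This is the recursion equation required by `nat_omega_rec'`: the answers of the children, as a
-- list of varying length, determine the answer of the query. Every number is a Gödel number, so a
-- case distinction on formulas is exhaustive.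
theorem combine_children (q : Query) :
    q.combine (q.children.map fun q => decide q.Holds) = some (decide q.Holds) := by
  obtain ⟨c, n, N, P, ρ⟩ := q
  obtain ⟨φ, rfl⟩ : ∃ φ : MPLFormula ℕ, n = φ.toNat := ⟨_, (MPLFormula.toNat_ofNat n).symm⟩
  have hφ := holds_toNat c φ N P ρ
  cases φ with
  | prop a x =>
    simp only [hφ, CodeSat]
    simp [combine, tag, HoldsAtom, argL, argR, arg, MPLFormula.toNat]
  | lt x y =>
    simp only [hφ, CodeSat]
    simp [combine, tag, HoldsAtom, argL, argR, arg, MPLFormula.toNat, Nat.mul_add_div]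
  | eq x y =>
    simp only [hφ, CodeSat]
    simp [combine, tag, HoldsAtom, argL, argR, arg, MPLFormula.toNat, Nat.mul_add_div]
  | mem x X =>
    simp only [hφ, CodeSat]
    simp [combine, tag, HoldsAtom, argL, argR, arg, MPLFormula.toNat, Nat.mul_add_div]
  | eqLevel x y =>
    simp only [hφ, CodeSat]
    simp [combine, tag, HoldsAtom, argL, argR, arg, MPLFormula.toNat, Nat.mul_add_div]
  | neg φ =>
    simp only [hφ, CodeSat]
    simp [combine, children, tag, arg, MPLFormula.toNat, Nat.mul_add_div, holds_toNat]
  | or φ ψ =>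
    simp only [hφ, CodeSat]
    simp [combine, children, tag, argL, argR, arg, MPLFormula.toNat, Nat.mul_add_div, holds_toNat]
  | exFO x φ =>
    obtain ⟨ht, h⟩ := holds_exFO c x φ N P ρ _ rfl
    exact combine_children_of_exists (by omega) h
  | exSO X φ =>
    obtain ⟨ht, h⟩ := holds_exSO c X φ N P ρ _ rfl
    exact combine_children_of_exists (by omega) h

theorem primrecPred_holds : PrimrecPred Holds := by
  classical
  exact Primrec.primrecPred (nat_omega_rec' (fun q => decide q.Holds) (m := fun q => q.2.1)
    (fst.comp snd) primrec_children primrec_combine lt_of_mem_children combine_children)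

end Query

theorem computable_codeSat : ∃ check : KripkeCode × MPLFormula ℕ → Bool, Computable check ∧
    ∀ c φ, check (c, φ) = true ↔ c.CodeSat φ 1 1 [] := by
  classical
  have hcode : Primrec fun p : KripkeCode × MPLFormula ℕ =>
      ((p.1, Encodable.encode p.2, 1, 1, []) : Query) :=
    Primrec.pair fst (Primrec.pair (Primrec.encode.comp snd) (const (1, 1, [])))
  refine ⟨_, (Query.primrecPred_holds.comp hcode).decide.to_comp, fun c φ => ?_⟩
  have : MPLFormula.ofNat (Encodable.encode φ) = φ := MPLFormula.ofNat_toNat φ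
  simp [Query.Holds, this]

end KripkeCode

theorem mainTheorem1 :
    ∃ check : KripkeCode × MPLFormula ℕ → Bool, Computable check ∧
      ∀ (S : Type*) (AP : Type*) (K : KripkeStructure S AP), K.IsFinite →
        (∃ (c : KripkeCode) (e : S ≃ Fin c.1.length) (ν : AP ↪ ℕ), c.Describes K e ν) ∧
        ∀ (c : KripkeCode) (e : S ≃ Fin c.1.length) (ν : AP ↪ ℕ), c.Describes K e ν →
          ∀ φ : MPLFormula AP, φ.IsClosed →
            (check (c, φ.map ν) = true ↔ MPLFormula.Models K φ) := by
  obtain ⟨check, hcheck, h⟩ := KripkeCode.computable_codeSat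
  refine ⟨check, hcheck, fun S AP K hK => ⟨KripkeCode.exists_describes hK,
    fun c e ν hD φ _ => ?_⟩⟩
  rw [h, KripkeCode.codeSat_iff_models hD hK.2.2]
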